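/- Let $R$ be a commutative artinian ring, let $\Lambda$ be an artin $R$-algebra (an $R$-algebra that is finitely generated as an $R$-module), let $\operatorname{mod}\Lambda$ be the category of finitely generated right $\Lambda$-modules, and let $U\in\operatorname{mod}\Lambda$ have finite injective dimension. Let ${}^\perp U$ be the full subcategory of $\operatorname{mod}\Lambda$ consisting of all $X$ with $\operatorname{Ext}^i_\Lambda(X,U)=0$ for all $i>0$. It is extension-closed, and we regard it as an exact category whose conflations are the short exact sequences of $\operatorname{mod}\Lambda$ with all terms in ${}^\perp U$. Let $\mathcal E$ be an exact category which is exact equivalent to ${}^\perp U$, that is, there is an equivalence of categories $\mathcal E\simeq{}^\perp U$ preserving and reflecting conflations. An object $X$ of $\mathcal E$ is *simple* if $X\neq 0$ and there is no conflation $L\rightarrowtail X\twoheadrightarrow N$ with $L,N\neq 0$; it is *projective* if every morphism from $X$ lifts along every deflation. An *inflation series* of $X$ of length $n$ is a sequence of inflations $0=X_0\rightarrowtail X_1\rightarrowtail\cdots\rightarrowtail X_n=X$; it is *proper* if none of these inflations is an isomorphism, and a *composition series* if all quotients $X_i/X_{i-1}$ are simple. Two inflation series are *isomorphic* if they have the same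 length and, up to a permutation of indices, isomorphic quotients. The category $\mathcal E$ satisfies the Jordan–Hölder property (JHP) if for every object the lengths of its proper inflation series are bounded (that is, $\mathcal E$ is a length exact category) and any two composition series of the same object are isomorphic. Then $\mathcal E$ satisfies (JHP) if and only if the number of isomorphism classes of simple objects of $\mathcal E$ is equal to the number of isomorphism classes of indecomposable projective objects of $\mathcal E$. -/

import Mathlib

open CategoryTheory CategoryTheory.Limits CategoryTheory.Abelian

universe v u v' u'

section ExactCategories

/-- `f` is the first map of a member of the class `K` of short complexes. -/
def IsInflationOf {C : Type u} [Category.{v} C] [HasZeroMorphisms C]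
    (K : ObjectProperty (ShortComplex C)) {X Y : C} (f : X ⟶ Y) : Prop :=
  ∃ (Z : C) (g : Y ⟶ Z) (w : f ≫ g = 0), K (ShortComplex.mk f g w)

/-- `g` is the second map of a member of the class `K` of short complexes. -/
def IsDeflationOf {C : Type u} [Category.{v} C] [HasZeroMorphisms C]
    (K : ObjectProperty (ShortComplex C)) {Y Z : C} (g : Y ⟶ Z) : Prop :=
  ∃ (X : C) (f : X ⟶ Y) (w : f ≫ g = 0), K (ShortComplex.mk f g w)

/-- A Quillen exact structure on an additive category: a class of kernel-cokernel pairs, the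
*conflations* `X ↣ Y ↠ Z`, closed under isomorphism, whose first maps (*inflations*) and second
maps (*deflations*) satisfy the axioms of Quillen in the form given by Keller and Bühler. -/
structure ExactStructure (C : Type u) [Category.{v} C] [Preadditive C] [HasZeroObject C]
    [HasBinaryBiproducts C] where
  /-- the class of conflations -/
  conflation : ObjectProperty (ShortComplex C)
  of_iso : ∀ {S T : ShortComplex C}, (S ≅ T) → conflation S → conflation T
  isKernel : ∀ {S : ShortComplex C}, conflation S → Nonempty (IsLimit (KernelFork.ofι S.f S.zero))
  isCokernel : ∀ {S : ShortComplex C}, conflation S →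
    Nonempty (IsColimit (CokernelCofork.ofπ S.g S.zero))
  inflation_id : ∀ X : C, IsInflationOf conflation (𝟙 X)
  deflation_id : ∀ X : C, IsDeflationOf conflation (𝟙 X)
  inflation_comp : ∀ {X Y Z : C} (f : X ⟶ Y) (g : Y ⟶ Z),
    IsInflationOf conflation f → IsInflationOf conflation g → IsInflationOf conflation (f ≫ g)
  deflation_comp : ∀ {X Y Z : C} (f : X ⟶ Y) (g : Y ⟶ Z),
    IsDeflationOf conflation f → IsDeflationOf conflation g → IsDeflationOf conflation (f ≫ g)
  inflation_pushout : ∀ {X Y X' : C} (f : X ⟶ Y) (a : X ⟶ X'), IsInflationOf conflation f →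
    ∃ (Y' : C) (b : Y ⟶ Y') (f' : X' ⟶ Y'), IsPushout f a b f' ∧ IsInflationOf conflation f'
  deflation_pullback : ∀ {Y Z Z' : C} (g : Y ⟶ Z) (a : Z' ⟶ Z), IsDeflationOf conflation g →
    ∃ (Y' : C) (b : Y' ⟶ Y) (g' : Y' ⟶ Z'), IsPullback b g' g a ∧ IsDeflationOf conflation g'

/-- Two exact categories are exact equivalent if there is an equivalence of categories which
preserves and reflects conflations (such an equivalence is automatically additive). -/
def ExactEquivalent {C : Type u} [Category.{v} C] [Preadditive C] [HasZeroObject C]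
    [HasBinaryBiproducts C] {D : Type u'} [Category.{v'} D] [Preadditive D] [HasZeroObject D]
    [HasBinaryBiproducts D] (𝓔 : ExactStructure C) (𝓕 : ExactStructure D) : Prop :=
  ∃ F : C ≌ D, ∀ S : ShortComplex C, 𝓔.conflation S ↔ 𝓕.conflation (S.map F.functor)

namespace ExactStructure

variable {C : Type u} [Category.{v} C] [Preadditive C] [HasZeroObject C] [HasBinaryBiproducts C]
variable (𝓔 : ExactStructure C)

/-- An object `X` is simple if it is nonzero and is not the middle term of a conflation whose outer
terms are both nonzero. -/
def IsSimple (X : C) : Prop :=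
  ¬ IsZero X ∧ ∀ S : ShortComplex C, 𝓔.conflation S → Nonempty (S.X₂ ≅ X) →
    IsZero S.X₁ ∨ IsZero S.X₃

/-- An object `P` is projective if every morphism from `P` lifts along every deflation. -/
def IsProjective (P : C) : Prop :=
  ∀ S : ShortComplex C, 𝓔.conflation S → ∀ f : P ⟶ S.X₃, ∃ h : P ⟶ S.X₂, h ≫ S.g = f

/-- (Admissible) inflation series `0 = X₀ ↣ X₁ ↣ ⋯ ↣ Xₙ = X` of `X`, with chosen quotients `Xᵢ / Xᵢ₋₁`: the
series `zero` of length `0` consists of a zero object, and `snoc` adds one more inflation at the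
top. -/
inductive InflationSeries : C → Type (max u v)
  | zero (X : C) (h : IsZero X) : InflationSeries X
  | snoc (S : ShortComplex C) (h : 𝓔.conflation S) (s : InflationSeries S.X₁) :
      InflationSeries S.X₂

namespace InflationSeries

variable {𝓔}

/-- The quotients `X₁ / X₀, …, Xₙ / Xₙ₋₁` (listed from the top down). -/
def factors : {X : C} → 𝓔.InflationSeries X → List C
  | _, zero _ _ => []
  | _, snoc S _ s => S.X₃ :: s.factors

/-- The length `n` of the series. -/
def length {X : C} (s : 𝓔.InflationSeries X) : ℕ := s.factors.length

/-- None of the inflations `Xᵢ₋₁ ↣ Xᵢ` is an isomorphism. -/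
def IsProper : {X : C} → 𝓔.InflationSeries X → Prop
  | _, zero _ _ => True
  | _, snoc S _ s => ¬ IsIso S.f ∧ s.IsProper

/-- A composition series: all the quotients `Xᵢ / Xᵢ₋₁` are simple objects. -/
def IsComposition {X : C} (s : 𝓔.InflationSeries X) : Prop :=
  ∀ Q ∈ s.factors, 𝓔.IsSimple Q

/-- Two inflation series are isomorphic if they have the same length and some permutation of the
indices matches isomorphic quotients, that is, if some bijection of their index sets does. -/
def Isomorphic {X Y : C} (s : 𝓔.InflationSeries X) (t : 𝓔.InflationSeries Y) : Prop :=
  ∃ σ : Fin s.factors.length ≃ Fin t.factors.length,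
    ∀ i, Nonempty (s.factors.get i ≅ t.factors.get (σ i))

end InflationSeries

/-- For every object, the lengths of its proper inflation series are bounded. -/
def IsLength : Prop :=
  ∀ X : C, ∃ N : ℕ, ∀ s : 𝓔.InflationSeries X, s.IsProper → s.length ≤ N

/-- The Jordan-Hölder property: the exact category is a length exact category and any two
composition series of the same object are isomorphic. -/
def JordanHolder : Prop :=
  𝓔.IsLength ∧ ∀ (X : C) (s t : 𝓔.InflationSeries X), s.IsComposition → t.IsComposition →
    s.Isomorphic t

/-- The set of isomorphism classes of simple objects. -/
def simpleClasses : Set (Quotient (isIsomorphicSetoid C)) :=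
  {c | ∃ X : C, 𝓔.IsSimple X ∧ Quotient.mk _ X = c}

/-- The set of isomorphism classes of indecomposable projective objects. -/
def indecProjectiveClasses : Set (Quotient (isIsomorphicSetoid C)) :=
  {c | ∃ X : C, Indecomposable X ∧ 𝓔.IsProjective X ∧ Quotient.mk _ X = c}

end ExactStructure

end ExactCategories

section ExtensionClosed

variable {A : Type u} [Category.{v} A] [Abelian A] (P : ObjectProperty A)

namespace ExtensionClosed

theorem prop_of_iso [P.ContainsZero] [P.IsClosedUnderExtensions] {X Y : A} (e : X ≅ Y)
    (h : P X) : P Y := by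
  obtain ⟨Z, hZ, hPZ⟩ := P.exists_prop_of_containsZero
  let S : ShortComplex A := ShortComplex.mk e.hom (0 : Y ⟶ Z) (by simp)
  have hS : S.ShortExact :=
    { exact := (ShortComplex.exact_iff_epi S rfl).2 (by dsimp [S]; infer_instance)
      mono_f := by dsimp [S]; infer_instance
      epi_g := ⟨fun _ _ _ => hZ.eq_of_src _ _⟩ }
  exact P.prop_X₂_of_shortExact hS h hPZ

instance [P.ContainsZero] [P.IsClosedUnderExtensions] : P.IsClosedUnderFiniteProducts := by
  have : P.IsClosedUnderIsomorphisms := ⟨fun e h => prop_of_iso P e h⟩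
  have : P.IsClosedUnderBinaryProducts := by
    refine ⟨?_⟩
    rintro X ⟨p⟩
    have h1 := p.prop_diag_obj ⟨WalkingPair.left⟩
    have h2 := p.prop_diag_obj ⟨WalkingPair.right⟩
    have h := P.prop_biprod h1 h2
    have e1 : IsLimit (BinaryFan.mk (p.π.app ⟨WalkingPair.left⟩) (p.π.app ⟨WalkingPair.right⟩)) := by
      refine (IsLimit.equivOfNatIsoOfIso (diagramIsoPair p.diag) _ _ ?_) p.isLimit
      exact Cone.ext (Iso.refl _) (by rintro ⟨⟨⟩⟩ <;> simp)
    exact P.prop_of_iso (IsLimit.conePointUniqueUpToIso (BinaryBiproduct.isLimit _ _) e1) h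
  exact ObjectProperty.IsClosedUnderFiniteProducts.mk'

instance [P.ContainsZero] [P.IsClosedUnderExtensions] :
    HasBinaryBiproducts P.FullSubcategory :=
  HasBinaryBiproducts.of_hasBinaryProducts

/-- A short complex in the full subcategory is a conflation if it is short exact in the ambient
abelian category. -/
def conflation : ObjectProperty (ShortComplex P.FullSubcategory) :=
  fun S => (S.map P.ι).ShortExact

theorem isInflation_iff [P.ContainsZero] [P.IsClosedUnderExtensions]
    {X Y : P.FullSubcategory} (f : X ⟶ Y) :
    IsInflationOf (conflation P) f ↔ Mono f.hom ∧ P (cokernel f.hom) := by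
  constructor
  · rintro ⟨Z, g, w, h⟩
    have h' : ((ShortComplex.mk f g w).map P.ι).ShortExact := h
    refine ⟨h'.mono_f, prop_of_iso P ?_ Z.property⟩
    exact IsColimit.coconePointUniqueUpToIso h'.gIsCokernel (colimit.isColimit _)
  · rintro ⟨hf, hP⟩
    refine ⟨⟨cokernel f.hom, hP⟩, ObjectProperty.homMk (cokernel.π f.hom), ?_, ?_⟩
    · ext
      exact cokernel.condition f.hom
    · exact
        { exact := ShortComplex.exact_of_g_is_cokernel _ (cokernelIsCokernel f.hom)
          mono_f := hf
          epi_g := inferInstanceAs (Epi (cokernel.π f.hom)) }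

theorem isDeflation_iff [P.ContainsZero] [P.IsClosedUnderExtensions]
    {X Y : P.FullSubcategory} (g : X ⟶ Y) :
    IsDeflationOf (conflation P) g ↔ Epi g.hom ∧ P (kernel g.hom) := by
  constructor
  · rintro ⟨Z, f, w, h⟩
    have h' : ((ShortComplex.mk f g w).map P.ι).ShortExact := h
    refine ⟨h'.epi_g, prop_of_iso P ?_ Z.property⟩
    exact IsLimit.conePointUniqueUpToIso h'.fIsKernel (limit.isLimit _)
  · rintro ⟨hf, hP⟩
    refine ⟨⟨kernel g.hom, hP⟩, ObjectProperty.homMk (kernel.ι g.hom), ?_, ?_⟩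
    · ext
      exact kernel.condition g.hom
    · exact
        { exact := ShortComplex.exact_of_f_is_kernel _ (kernelIsKernel g.hom)
          mono_f := inferInstanceAs (Mono (kernel.ι g.hom))
          epi_g := hf }

theorem prop_cokernel_comp [P.IsClosedUnderExtensions] {X Y Z : A} (f : X ⟶ Y) (g : Y ⟶ Z)
    [Mono g] (hf : P (cokernel f)) (hg : P (cokernel g)) : P (cokernel (f ≫ g)) := by
  have hz : IsZero (kernel g) := isZero_kernel_of_mono g
  have E := kernelCokernelCompSequence_exact f g
  let S : ShortComplex A := ShortComplex.mk (cokernel.map f (f ≫ g) (𝟙 _) g (by simp))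
    (cokernel.map (f ≫ g) g f (𝟙 _) (by simp)) (E.toIsComplex.zero 3)
  have hS : S.ShortExact :=
    { exact := E.exact 3
      mono_f := (E.exact 2).mono_g (hz.eq_of_src _ _)
      epi_g := by
        have : Epi (cokernel.π (f ≫ g) ≫ S.g) := by
          dsimp [S]
          simp only [cokernel.π_desc, Category.id_comp]
          infer_instance
        exact epi_of_epi (cokernel.π (f ≫ g)) S.g }
  exact P.prop_X₂_of_shortExact hS hf hg

theorem prop_kernel_comp [P.IsClosedUnderExtensions] {X Y Z : A} (f : X ⟶ Y) (g : Y ⟶ Z)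
    [Epi f] (hf : P (kernel f)) (hg : P (kernel g)) : P (kernel (f ≫ g)) := by
  have hz : IsZero (cokernel f) := isZero_cokernel_of_epi f
  have E := kernelCokernelCompSequence_exact f g
  let S : ShortComplex A := ShortComplex.mk (kernel.map f (f ≫ g) (𝟙 _) g (by simp))
    (kernel.map (f ≫ g) g f (𝟙 _) (by simp)) (E.toIsComplex.zero 0)
  have hS : S.ShortExact :=
    { exact := E.exact 0
      mono_f := by
        have : Mono (S.f ≫ kernel.ι (f ≫ g)) := by
          dsimp [S]
          simp only [kernel.lift_ι, Category.comp_id]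
          infer_instance
        exact mono_of_mono S.f (kernel.ι (f ≫ g))
      epi_g := (E.exact 1).epi_f (hz.eq_of_tgt _ _) }
  exact P.prop_X₂_of_shortExact hS hf hg

end ExtensionClosed

open ExtensionClosed in
/-- The natural exact structure on an extension-closed full subcategory (containing zero) of an
abelian category: the conflations are the short exact sequences with all terms in the
subcategory. -/
def ExactStructure.ofExtensionClosed [P.ContainsZero] [P.IsClosedUnderExtensions] :
    ExactStructure P.FullSubcategory where
  conflation := ExtensionClosed.conflation P
  of_iso e h := ShortComplex.shortExact_of_iso (P.ι.mapShortComplex.mapIso e) h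
  isKernel {S} h := ⟨isLimitOfReflects P.ι ((KernelFork.isLimitMapConeEquiv _ _).symm
    (ShortComplex.ShortExact.fIsKernel h))⟩
  isCokernel {S} h := ⟨isColimitOfReflects P.ι ((CokernelCofork.isColimitMapCoconeEquiv _ _).symm
    (ShortComplex.ShortExact.gIsCokernel h))⟩
  inflation_id X := (isInflation_iff P (𝟙 X)).2
    ⟨inferInstanceAs (Mono (𝟙 X.obj)), by
      obtain ⟨Z, hZ, hPZ⟩ := P.exists_prop_of_containsZero
      exact prop_of_iso P (hZ.iso (isZero_cokernel_of_epi (𝟙 X.obj))) hPZ⟩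
  deflation_id X := (isDeflation_iff P (𝟙 X)).2
    ⟨inferInstanceAs (Epi (𝟙 X.obj)), by
      obtain ⟨Z, hZ, hPZ⟩ := P.exists_prop_of_containsZero
      exact prop_of_iso P (hZ.iso (isZero_kernel_of_mono (𝟙 X.obj))) hPZ⟩
  inflation_comp f g hf hg := by
    obtain ⟨h1, h2⟩ := (isInflation_iff P _).1 hf
    obtain ⟨h3, h4⟩ := (isInflation_iff P _).1 hg
    exact (isInflation_iff P _).2 ⟨mono_comp f.hom g.hom, prop_cokernel_comp P _ _ h2 h4⟩
  deflation_comp f g hf hg := by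
    obtain ⟨h1, h2⟩ := (isDeflation_iff P _).1 hf
    obtain ⟨h3, h4⟩ := (isDeflation_iff P _).1 hg
    exact (isDeflation_iff P _).2 ⟨epi_comp f.hom g.hom, prop_kernel_comp P _ _ h2 h4⟩
  inflation_pushout {X Y X'} f a hf := by
    obtain ⟨h1, h2⟩ := (isInflation_iff P _).1 hf
    have sq := IsPushout.of_hasPushout f.hom a.hom
    have hm : Mono (pushout.inr f.hom a.hom) := inferInstance
    have hi := isIso_cokernel_map_of_isPushout sq
    have hc : P (cokernel (pushout.inr f.hom a.hom)) :=
      prop_of_iso P (asIso (cokernel.map _ _ _ _ sq.w)) h2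
    have hp : P (pushout f.hom a.hom) := P.prop_X₂_of_shortExact
      (S := ShortComplex.mk _ _ (cokernel.condition (pushout.inr f.hom a.hom)))
      { exact := ShortComplex.exact_of_g_is_cokernel _ (cokernelIsCokernel _)
        mono_f := hm
        epi_g := inferInstanceAs (Epi (cokernel.π _)) } X'.property hc
    refine ⟨⟨pushout f.hom a.hom, hp⟩, ObjectProperty.homMk (pushout.inl f.hom a.hom),
      ObjectProperty.homMk (pushout.inr f.hom a.hom), ?_, ?_⟩
    swap
    · rw [isInflation_iff]
      exact ⟨hm, hc⟩
    exact IsPushout.of_map P.ι (by ext; exact sq.w) sq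
  deflation_pullback {Y Z Z'} g a hg := by
    obtain ⟨h1, h2⟩ := (isDeflation_iff P _).1 hg
    have sq := (IsPullback.of_hasPullback g.hom a.hom).flip
    have hm : Epi (pullback.snd g.hom a.hom) := inferInstance
    have hi := isIso_kernel_map_of_isPullback sq
    have hc : P (kernel (pullback.snd g.hom a.hom)) :=
      prop_of_iso P (asIso (kernel.map _ _ _ _ sq.w)).symm h2
    have hp : P (pullback g.hom a.hom) := P.prop_X₂_of_shortExact
      (S := ShortComplex.mk _ _ (kernel.condition (pullback.snd g.hom a.hom)))
      { exact := ShortComplex.exact_of_f_is_kernel _ (kernelIsKernel _)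
        mono_f := inferInstanceAs (Mono (kernel.ι _))
        epi_g := hm } hc Z'.property
    refine ⟨⟨pullback g.hom a.hom, hp⟩, ObjectProperty.homMk (pullback.fst g.hom a.hom),
      ObjectProperty.homMk (pullback.snd g.hom a.hom), ?_, ?_⟩
    swap
    · rw [isDeflation_iff]
      exact ⟨hm, hc⟩
    exact IsPullback.of_map P.ι (by ext; exact sq.w.symm) sq.flip

end ExtensionClosed

section Perp

variable (Λ : Type u) [Ring Λ]

/-- `mod Λ` consists of the finitely generated right `Λ`-modules, that is, left modules over the
opposite ring; `perp Λ U` is its full subcategory of those `X` with `Extⁱ(X, U) = 0` for all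
`i > 0`. -/
def perp (U : ModuleCat.{u} Λᵐᵒᵖ) : ObjectProperty (ModuleCat.{u} Λᵐᵒᵖ) :=
  fun X => Module.Finite Λᵐᵒᵖ X ∧ ∀ i : ℕ, 0 < i → Subsingleton (Ext X U i)

instance (U : ModuleCat.{u} Λᵐᵒᵖ) : (perp Λ U).ContainsZero where
  exists_zero := by
    have hz : IsZero (ModuleCat.of Λᵐᵒᵖ PUnit.{u + 1}) := ModuleCat.isZero_of_subsingleton _
    refine ⟨_, hz, ?_, fun i _ => subsingleton_of_forall_eq 0 fun x => ?_⟩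
    · change Module.Finite Λᵐᵒᵖ PUnit.{u + 1}
      infer_instance
    · rw [← Ext.mk₀_id_comp x, hz.eq_of_src (𝟙 _) 0, Ext.mk₀_zero, Ext.zero_comp]

instance (U : ModuleCat.{u} Λᵐᵒᵖ) : (perp Λ U).IsClosedUnderExtensions where
  prop_X₂_of_shortExact {S} hS h₁ h₃ := by
    refine ⟨?_, fun i hi => ?_⟩
    · have := h₁.1
      have := h₃.1
      exact Module.Finite.of_exact (f := S.f.hom) (g := S.g.hom)
        ((ShortComplex.ShortExact.moduleCat_exact_iff_function_exact S).1 hS.exact)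
        hS.moduleCat_surjective_g
    · have := h₁.2 i hi
      have := h₃.2 i hi
      refine subsingleton_of_forall_eq 0 fun x => ?_
      obtain ⟨y, rfl⟩ := Ext.contravariant_sequence_exact₂ hS U x (Subsingleton.elim _ _)
      rw [Subsingleton.elim y 0, Ext.comp_zero]

end Perp

/-! The theorem is linear algebra in the rationalised Grothendieck group of `mod Λ`. Each
indecomposable projective `P_j` has, up to isomorphism, one simple quotient `S_j`, and these are all
the simple modules. The length of `Hom(P_j, M)` over `End(P_j)` counts `S_j` in `M`. The resulting
vector `d M` is additive, has `d (S_j) = e_j`, and every additive function from finitely generated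
modules to a rational vector space is a linear function of `d` (`exists_multiplicity`,
`AdditiveOn.mem_of_simple`).

Finite injective dimension of `U` gives every finitely generated module a finite resolution by
objects of `⊥U`. Hence additive functions on `⊥U` extend to `mod Λ` by alternating sums
(`AdditiveOn.exists_extension`), and the vectors `d X` with `X` in `⊥U` span the whole space
(`AdditiveOn.mem_of_extBounded`). Composition series exist in the exact category, so already the
vectors of its simple objects span.

Under (JHP) the multiset of composition factors is additive on conflations. Its extension to `mod Λ`
gives a linear map sending the vectors of the simple objects to distinct basis vectors; they are
therefore independent, form a basis, and the two numbers agree. Conversely, if the numbers agree, a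
spanning family with as many members as the dimension is a basis, so `d X` determines the
multiplicities in any composition series of `X`. Boundedness of proper series is automatic, since
module length bounds them. -/

/-! ### Projectives satisfying Fitting's dichotomy and their simple quotients -/

section ProjectiveTops

variable {A : Type u} [Ring A]

/-- Fitting's dichotomy: every endomorphism of `P` is nilpotent or bijective. -/
def FittingDichotomy (A : Type*) [Ring A] (P : Type*) [AddCommGroup P] [Module A P] : Prop :=
  ∀ φ : Module.End A P, IsNilpotent φ ∨ Function.Bijective φ

theorem fittingDichotomy_of_isCompl {P : Type*} [AddCommGroup P] [Module A P]
    [IsArtinian A P] [IsNoetherian A P]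
    (h : ∀ N₁ N₂ : Submodule A P, IsCompl N₁ N₂ → N₁ = ⊥ ∨ N₂ = ⊥) : FittingDichotomy A P := by
  intro φ
  obtain ⟨n, hn⟩ := Filter.eventually_atTop.1 φ.eventually_isCompl_ker_pow_range_pow
  -- A positive exponent lets one factor `φ` be split off, so that bijectivity of the power passes
  -- to `φ`.
  have hc := hn (n + 1) n.le_succ
  rcases h _ _ hc with h | h
  · right
    have hr := eq_top_of_isCompl_bot (h ▸ hc).symm
    constructor
    · rw [← LinearMap.ker_eq_bot, eq_bot_iff, ← h, pow_succ]
      exact LinearMap.ker_le_ker_comp φ (φ ^ n)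
    · rw [← LinearMap.range_eq_top, eq_top_iff, ← hr, pow_succ']
      exact LinearMap.range_comp_le_range (φ ^ n) φ
  · left
    exact ⟨n + 1, LinearMap.range_eq_bot.1 h⟩

/-- Iterating gives `f ∘ φ ^ n = f` for all `n`, so a nilpotent `φ` would force `f = 0`. -/
theorem FittingDichotomy.bijective {P S : Type*} [AddCommGroup P] [Module A P]
    [AddCommGroup S] [Module A S] (hP : FittingDichotomy A P) {f : P →ₗ[A] S} (hf : f ≠ 0)
    {φ : Module.End A P} (h : f ∘ₗ φ = f) : Function.Bijective φ := by
  refine (hP φ).resolve_left fun ⟨n, hn⟩ => hf ?_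
  have key : ∀ n, f ∘ₗ (φ ^ n) = f := by
    intro n
    induction n with
    | zero => rfl
    | succ n ih =>
      rw [pow_succ']
      change (f ∘ₗ φ) ∘ₗ (φ ^ n) = f
      rw [h, ih]
  rw [← key n, hn, LinearMap.comp_zero]

variable {P P' S S' : Type*} [AddCommGroup P] [Module A P] [AddCommGroup P'] [Module A P']
  [AddCommGroup S] [Module A S] [AddCommGroup S'] [Module A S']

/-- Uniqueness of projective covers: lift `f` and `g` through each other; both composites of the
lifts fix a nonzero map to `S`, hence are bijective. -/
theorem FittingDichotomy.nonempty_linearEquiv [Module.Projective A P] [Module.Projective A P']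
    [IsSimpleModule A S] (hP : FittingDichotomy A P) (hP' : FittingDichotomy A P')
    {f : P →ₗ[A] S} {g : P' →ₗ[A] S} (hf : f ≠ 0) (hg : g ≠ 0) : Nonempty (P ≃ₗ[A] P') := by
  obtain ⟨h, hh⟩ := Module.projective_lifting_property g f (LinearMap.surjective_of_ne_zero hg)
  obtain ⟨k, hk⟩ := Module.projective_lifting_property f g (LinearMap.surjective_of_ne_zero hf)
  have h1 := hP.bijective (φ := k ∘ₗ h) hf (by rw [← LinearMap.comp_assoc, hk, hh])
  have h2 := hP'.bijective (φ := h ∘ₗ k) hg (by rw [← LinearMap.comp_assoc, hh, hk])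
  exact ⟨LinearEquiv.ofBijective h ⟨Function.Injective.of_comp h1.1,
    Function.Surjective.of_comp h2.2⟩⟩

/-- Otherwise `g` maps `ker f` onto `S'`, and `g` lifts to a map from `P` into `ker f`. As an
endomorphism of `P` this lift fixes `g`, so it is bijective and `ker f` is everything. -/
theorem FittingDichotomy.ker_le [Module.Projective A P] [IsSimpleModule A S]
    [IsSimpleModule A S'] (hP : FittingDichotomy A P)
    {f : P →ₗ[A] S} {g : P →ₗ[A] S'} (hf : f ≠ 0) (hg : g ≠ 0) :
    LinearMap.ker f ≤ LinearMap.ker g := by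
  by_contra hle
  have hr : g ∘ₗ (LinearMap.ker f).subtype ≠ 0 := by
    intro h0
    refine hle fun x hx => ?_
    exact LinearMap.congr_fun h0 ⟨x, hx⟩
  obtain ⟨h, hh⟩ := Module.projective_lifting_property _ g (LinearMap.surjective_of_ne_zero hr)
  have hb := hP.bijective (φ := (LinearMap.ker f).subtype ∘ₗ h) hg
    (by rw [← LinearMap.comp_assoc, hh])
  refine hf (LinearMap.ext fun x => ?_)
  obtain ⟨y, rfl⟩ := hb.2 x
  exact (h y).2

theorem FittingDichotomy.nonempty_linearEquiv_of_simple [Module.Projective A P]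
    [IsSimpleModule A S] [IsSimpleModule A S'] (hP : FittingDichotomy A P)
    {f : P →ₗ[A] S} {g : P →ₗ[A] S'} (hf : f ≠ 0) (hg : g ≠ 0) : Nonempty (S ≃ₗ[A] S') := by
  have hk := le_antisymm (hP.ker_le hf hg) (hP.ker_le hg hf)
  exact ⟨(f.quotKerEquivOfSurjective (LinearMap.surjective_of_ne_zero hf)).symm ≪≫ₗ
    Submodule.quotEquivOfEq _ _ hk ≪≫ₗ
    g.quotKerEquivOfSurjective (LinearMap.surjective_of_ne_zero hg)⟩

end ProjectiveTops

/-! ### Multiplicities as lengths of Hom modules -/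

section Multiplicity

variable {A : Type*} [Ring A] (P : Type*) [AddCommGroup P] [Module A P]
variable {M N L S : Type*} [AddCommGroup M] [Module A M] [AddCommGroup N] [Module A N]
  [AddCommGroup L] [Module A L] [AddCommGroup S] [Module A S]

/-- Postcomposition as a map of modules over the endomorphism ring of the source. -/
def homPostcomp (f : M →ₗ[A] N) :
    (P →ₗ[A] M) →ₗ[(Module.End A P)ᵈᵐᵃ] (P →ₗ[A] N) where
  toFun g := f ∘ₗ g
  map_add' _ _ := LinearMap.comp_add _ _ _
  map_smul' _ _ := rfl

variable (M) in
/-- The length of `Hom(P, M)` over the endomorphism ring of `P`; if `P` is the projective cover of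
a simple module `S`, it is the multiplicity of `S` as a composition factor of `M`. -/
noncomputable def homLength : ℕ∞ := Module.length (Module.End A P)ᵈᵐᵃ (P →ₗ[A] M)

theorem homLength_eq_add [Module.Projective A P] {f : N →ₗ[A] M} {g : M →ₗ[A] L}
    (hf : Function.Injective f) (hg : Function.Surjective g) (h : Function.Exact f g) :
    homLength (A := A) P M = homLength (A := A) P N + homLength (A := A) P L := by
  refine Module.length_eq_add_of_exact (homPostcomp P f) (homPostcomp P g) ?_ ?_ ?_
  · intro a b hab
    ext x
    exact hf (LinearMap.congr_fun hab x)
  · intro a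
    exact Module.projective_lifting_property g a hg
  · intro a
    constructor
    · intro ha
      have hr : ∀ x, a x ∈ LinearMap.range f := fun x =>
        (h (a x)).1 (LinearMap.congr_fun ha x)
      let e := LinearEquiv.ofInjective f hf
      refine ⟨e.symm.toLinearMap ∘ₗ a.codRestrict _ hr, LinearMap.ext fun x => ?_⟩
      change f (e.symm (a.codRestrict _ hr x)) = a x
      have := e.apply_symm_apply (a.codRestrict _ hr x)
      exact congrArg Subtype.val this
    · rintro ⟨b, rfl⟩
      exact LinearMap.ext fun x => (h _).2 ⟨b x, rfl⟩

theorem homLength_eq_zero (h : ∀ f : P →ₗ[A] M, f = 0) : homLength (A := A) P M = 0 := by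
  have : Subsingleton (P →ₗ[A] M) := ⟨fun f g => (h f).trans (h g).symm⟩
  exact Module.length_eq_zero

/-- Every nonzero map to `S` is onto, so any other map from `P` factors through it by an
endomorphism of `P`: each nonzero element generates `Hom(P, S)`. -/
theorem homLength_eq_one [Module.Projective A P] [IsSimpleModule A S] {f : P →ₗ[A] S}
    (hf : f ≠ 0) : homLength (A := A) P S = 1 := by
  have : Nontrivial (P →ₗ[A] S) := ⟨⟨f, 0, hf⟩⟩
  refine Module.length_eq_one_iff.2 (isSimpleModule_iff_toSpanSingleton_surjective.2
    ⟨inferInstance, fun g hg k => ?_⟩)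
  obtain ⟨φ, hφ⟩ := Module.projective_lifting_property g k (LinearMap.surjective_of_ne_zero hg)
  exact ⟨DomMulAct.mk φ, hφ⟩

theorem homLength_ne_top [Module.Projective A P] {M : Type u} [AddCommGroup M] [Module A M]
    (hM : IsFiniteLength A M) : homLength (A := A) P M ≠ ⊤ := by
  induction hM with
  | of_subsingleton =>
    rw [homLength_eq_zero P fun f => LinearMap.ext fun x => Subsingleton.elim _ _]
    exact ENat.zero_ne_top
  | @of_simple_quotient M _ _ N _ _ ih =>
    rw [homLength_eq_add P N.injective_subtype N.mkQ_surjective (LinearMap.exact_subtype_mkQ N)]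
    refine WithTop.add_ne_top.2 ⟨ih, ?_⟩
    by_cases h : ∀ f : P →ₗ[A] (M ⧸ N), f = 0
    · rw [homLength_eq_zero P h]
      exact ENat.zero_ne_top
    · obtain ⟨f, hf⟩ := not_forall.1 h
      rw [homLength_eq_one P hf]
      exact ENat.one_ne_top

end Multiplicity

/-! ### Additive functions and resolutions of length one -/

section AdditiveFunctions

variable {𝓐 : Type u} [Category.{v} 𝓐] [Abelian 𝓐] {V : Type*} [AddCommGroup V]

/-- A function on objects is additive on a class `Q` if it is additive on the short exact sequences
with all terms in `Q`. -/
def AdditiveOn (Q : ObjectProperty 𝓐) (m : 𝓐 → V) : Prop :=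
  ∀ S : ShortComplex 𝓐, S.ShortExact → Q S.X₁ → Q S.X₂ → Q S.X₃ → m S.X₂ = m S.X₁ + m S.X₃

theorem shortExact_kernel {X Y : 𝓐} (f : X ⟶ Y) [Epi f] :
    (ShortComplex.mk (kernel.ι f) f (kernel.condition f)).ShortExact where
  exact := ShortComplex.exact_of_f_is_kernel _ (kernelIsKernel f)
  mono_f := inferInstanceAs (Mono (kernel.ι f))
  epi_g := ‹_›

theorem shortExact_of_isIso_of_isZero {X Y Z : 𝓐} (f : X ⟶ Y) [IsIso f] (hZ : IsZero Z) :
    (ShortComplex.mk f (0 : Y ⟶ Z) (by simp)).ShortExact where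
  exact := (ShortComplex.exact_iff_epi _ rfl).2 (by dsimp; infer_instance)
  mono_f := by dsimp; infer_instance
  epi_g := ⟨fun _ _ _ => hZ.eq_of_src _ _⟩

theorem AdditiveOn.map_isZero {Q : ObjectProperty 𝓐} {m : 𝓐 → V} (hm : AdditiveOn Q m)
    {Z : 𝓐} (hZ : IsZero Z) (h : Q Z) : m Z = 0 := by
  simpa using hm _ (shortExact_of_isIso_of_isZero (𝟙 Z) hZ) h h h

theorem AdditiveOn.map_iso {Q : ObjectProperty 𝓐} [Q.ContainsZero] {m : 𝓐 → V}
    (hm : AdditiveOn Q m) {X Y : 𝓐} (e : X ≅ Y) (hX : Q X) (hY : Q Y) : m X = m Y := by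
  obtain ⟨Z, hZ, hQ⟩ := Q.exists_prop_of_containsZero
  have h := hm _ (shortExact_of_isIso_of_isZero e.hom hZ) hX hY hQ
  simpa [hm.map_isZero hZ hQ] using h.symm

/-- The sequence of kernels of `p`, `p ≫ S.g` and `S.g` for an epimorphism `p`. -/
theorem exists_shortExact_kernel_comp {S : ShortComplex 𝓐} (hS : S.ShortExact) {X : 𝓐}
    (p : X ⟶ S.X₂) [Epi p] :
    ∃ (a : kernel p ⟶ kernel (p ≫ S.g)) (b : kernel (p ≫ S.g) ⟶ S.X₁) (w : a ≫ b = 0),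
      (ShortComplex.mk a b w).ShortExact := by
  have hz : IsZero (cokernel p) := isZero_cokernel_of_epi p
  have E := kernelCokernelCompSequence_exact p S.g
  let T : ShortComplex 𝓐 := ShortComplex.mk (kernel.map p (p ≫ S.g) (𝟙 _) S.g (by simp))
    (kernel.map (p ≫ S.g) S.g p (𝟙 _) (by simp)) (E.toIsComplex.zero 0)
  have hT : T.ShortExact :=
    { exact := E.exact 0
      mono_f := by
        have : Mono (T.f ≫ kernel.ι (p ≫ S.g)) := by
          dsimp [T]
          simp only [kernel.lift_ι, Category.comp_id]
          infer_instance
        exact mono_of_mono T.f (kernel.ι (p ≫ S.g))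
      epi_g := (E.exact 1).epi_f (hz.eq_of_tgt _ _) }
  let e : kernel S.g ≅ S.X₁ := IsLimit.conePointUniqueUpToIso (limit.isLimit _) hS.fIsKernel
  have w : T.f ≫ T.g ≫ e.hom = 0 := by rw [← Category.assoc, T.zero, zero_comp]
  refine ⟨T.f, T.g ≫ e.hom, w, ?_⟩
  exact ShortComplex.shortExact_of_iso
    (ShortComplex.isoMk (S₁ := T) (S₂ := ShortComplex.mk T.f (T.g ≫ e.hom) w)
      (Iso.refl _) (Iso.refl _) e (by simp) (by simp)) hT

variable {P Q : ObjectProperty 𝓐} [P.IsClosedUnderExtensions] [P.ContainsZero]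

/-- Schanuel's argument: the pullback of two presentations of `S.X₃` is an extension of either
middle term by the kernel of the other, and comparing the two values of `m` on it gives the
equality. Thus the Euler characteristic of a resolution is independent of the resolution. -/
theorem AdditiveOn.sub_eq_sub {m : 𝓐 → V} (hm : AdditiveOn P m)
    (hker : ∀ S : ShortComplex 𝓐, S.ShortExact → P S.X₂ → Q S.X₃ → P S.X₁)
    {S : ShortComplex 𝓐} (hS : S.ShortExact) (h₂ : P S.X₂) (h₃ : Q S.X₃) {X : 𝓐}
    (f : X ⟶ S.X₃) [Epi f] (hX : P X) : m S.X₂ - m S.X₁ = m X - m (kernel f) := by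
  have := hS.epi_g
  have sq := IsPullback.of_hasPullback S.g f
  have hp1 : Epi (pullback.fst S.g f) := inferInstance
  have hp2 : Epi (pullback.snd S.g f) := inferInstance
  have h1 : P S.X₁ := hker S hS h₂ h₃
  have hk : P (kernel f) := hker _ (shortExact_kernel f) hX h₃
  have i1 := isIso_kernel_map_of_isPullback sq
  have i2 := isIso_kernel_map_of_isPullback sq.flip
  let e1 : kernel (pullback.snd S.g f) ≅ S.X₁ :=
    (asIso (kernel.map _ _ _ _ sq.flip.w)) ≪≫
      IsLimit.conePointUniqueUpToIso (limit.isLimit _) hS.fIsKernel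
  let e2 : kernel (pullback.fst S.g f) ≅ kernel f := asIso (kernel.map _ _ _ _ sq.w)
  have k1 : P (kernel (pullback.snd S.g f)) := ExtensionClosed.prop_of_iso P e1.symm h1
  have k2 : P (kernel (pullback.fst S.g f)) := ExtensionClosed.prop_of_iso P e2.symm hk
  have hW : P (pullback S.g f) := P.prop_X₂_of_shortExact (shortExact_kernel _) k1 hX
  have a1 := hm _ (shortExact_kernel (pullback.snd S.g f)) k1 hW hX
  have a2 := hm _ (shortExact_kernel (pullback.fst S.g f)) k2 hW h₂
  dsimp only at a1 a2
  rw [hm.map_iso e1 k1 h1] at a1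
  rw [hm.map_iso e2 k2 hk] at a2
  rw [sub_eq_sub_iff_add_eq_add, add_comm (m S.X₂), ← a2, a1, add_comm]

/-- An additive function on a class `P` extends to every larger class whose objects have resolutions
of length one by objects of `P`. -/
theorem AdditiveOn.exists_extension {m : 𝓐 → V} (hm : AdditiveOn P m) (hPQ : P ≤ Q)
    (hker : ∀ S : ShortComplex 𝓐, S.ShortExact → P S.X₂ → Q S.X₃ → P S.X₁)
    (hres : ∀ M, Q M → ∃ (X : 𝓐) (f : X ⟶ M), P X ∧ Epi f) :
    ∃ m' : 𝓐 → V, AdditiveOn Q m' ∧ ∀ M, P M → m' M = m M := by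
  classical
  choose! X hX using hres
  choose! f hf using hX
  let m' : 𝓐 → V := fun M => m (X M) - m (kernel (f M))
  have key : ∀ S : ShortComplex 𝓐, S.ShortExact → P S.X₂ → Q S.X₃ →
      m' S.X₃ = m S.X₂ - m S.X₁ := fun S hS h₂ h₃ =>
    have := (hf S.X₃ h₃).2
    (hm.sub_eq_sub hker hS h₂ h₃ (f S.X₃) (hf _ h₃).1).symm
  refine ⟨m', fun S hS h₁ h₂ h₃ => ?_, fun M hM => ?_⟩
  · have := hS.epi_g
    have hp := (hf _ h₂).2
    -- One object of `P` covers both `S.X₂` and `S.X₃`; the inclusion of the two kernels is then a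
    -- resolution of `S.X₁`, and the three Euler characteristics telescope.
    obtain ⟨a, b, w, hT⟩ := exists_shortExact_kernel_comp hS (f S.X₂)
    have hq : Epi (f S.X₂ ≫ S.g) := epi_comp _ _
    have e2 := key _ (shortExact_kernel (f S.X₂)) (hf _ h₂).1 h₂
    have e3 := key _ (shortExact_kernel (f S.X₂ ≫ S.g)) (hf _ h₂).1 h₃
    have e1 := key _ hT (hker _ (shortExact_kernel (f S.X₂ ≫ S.g)) (hf _ h₂).1 h₃) h₁
    dsimp only at e1 e2 e3
    rw [e1, e2, e3]
    abel
  · have hq := hPQ _ hM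
    have := (hf _ hq).2
    have hs := shortExact_kernel (f M)
    have h := hm _ hs (hker _ hs (hf _ hq).1 hq) (hf _ hq).1 hM
    dsimp only at h
    change m (X M) - m (kernel (f M)) = m M
    rw [h, add_sub_cancel_left]

end AdditiveFunctions

/-! ### The filtration of finitely generated modules by vanishing of Ext into `U` -/

section ExtBounded

variable {A : Type u} [Ring A] (U : ModuleCat.{u} A)

/-- The finitely generated modules `X` with `Extⁱ(X, U) = 0` for all `i > k`. -/
def extBounded (k : ℕ) : ObjectProperty (ModuleCat.{u} A) :=
  fun X => Module.Finite A X ∧ ∀ i : ℕ, k < i → Subsingleton (Ext X U i)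

variable {U}

theorem extBounded_mono {k l : ℕ} (h : k ≤ l) : extBounded U k ≤ extBounded U l :=
  fun _ hX => ⟨hX.1, fun i hi => hX.2 i (h.trans_lt hi)⟩

theorem extBounded_of_projective (k : ℕ) (X : ModuleCat.{u} A) [Module.Finite A X]
    [Module.Projective A X] : extBounded U k X := by
  have : Projective X := X.projective_of_categoryTheory_projective
  refine ⟨inferInstance, fun i hi => ?_⟩
  obtain ⟨j, rfl⟩ := Nat.exists_eq_succ_of_ne_zero (by omega : i ≠ 0)
  exact subsingleton_of_forall_eq 0 fun x => Ext.eq_zero_of_projective x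

theorem extBounded_of_hasInjectiveDimensionLE {n : ℕ} [HasInjectiveDimensionLE U n]
    (X : ModuleCat.{u} A) [Module.Finite A X] : extBounded U n X :=
  ⟨inferInstance, fun _ hi => subsingleton_of_forall_eq 0 fun x =>
    x.eq_zero_of_hasInjectiveDimensionLT (n + 1) hi⟩

theorem moduleFinite_of_shortExact {S : ShortComplex (ModuleCat.{u} A)} (hS : S.ShortExact)
    (h₁ : Module.Finite A S.X₁) (h₃ : Module.Finite A S.X₃) : Module.Finite A S.X₂ :=
  Module.Finite.of_exact (f := S.f.hom) (g := S.g.hom)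
    ((ShortComplex.ShortExact.moduleCat_exact_iff_function_exact S).1 hS.exact)
    hS.moduleCat_surjective_g

instance (k : ℕ) : (extBounded U k).ContainsZero where
  exists_zero := ⟨ModuleCat.of A PUnit.{u + 1}, ModuleCat.isZero_of_subsingleton _,
    extBounded_of_projective k _⟩

instance (k : ℕ) : (extBounded U k).IsClosedUnderExtensions where
  prop_X₂_of_shortExact {S} hS h₁ h₃ := by
    refine ⟨moduleFinite_of_shortExact hS h₁.1 h₃.1, fun i hi => ?_⟩
    have := h₁.2 i hi
    have := h₃.2 i hi
    refine subsingleton_of_forall_eq 0 fun x => ?_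
    obtain ⟨y, rfl⟩ := Ext.contravariant_sequence_exact₂ hS U x (Subsingleton.elim _ _)
    rw [Subsingleton.elim y 0, Ext.comp_zero]

/-- Dimension shift: `Extⁱ(S.X₁, U)` lies between `Extⁱ(S.X₂, U)` and `Extⁱ⁺¹(S.X₃, U)` in the long
exact sequence. -/
theorem extBounded_X₁ [IsNoetherianRing A] {k : ℕ} {S : ShortComplex (ModuleCat.{u} A)}
    (hS : S.ShortExact) (h₂ : extBounded U k S.X₂) (h₃ : extBounded U (k + 1) S.X₃) :
    extBounded U k S.X₁ := by
  have := h₂.1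
  refine ⟨Module.Finite.of_injective S.f.hom hS.moduleCat_injective_f, fun i hi => ?_⟩
  have := h₂.2 i hi
  have := h₃.2 (1 + i) (by omega)
  refine subsingleton_of_forall_eq 0 fun x => ?_
  obtain ⟨y, rfl⟩ := Ext.contravariant_sequence_exact₁ hS U x rfl (Subsingleton.elim _ _)
  rw [Subsingleton.elim y 0, Ext.comp_zero]

theorem exists_epi_of_finite (M : ModuleCat.{u} A) [Module.Finite A M] :
    ∃ (X : ModuleCat.{u} A) (f : X ⟶ M), Module.Finite A X ∧ Module.Projective A X ∧ Epi f := by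
  obtain ⟨n, f, hf⟩ := Module.Finite.exists_fin' A M
  exact ⟨ModuleCat.of A (Fin n → A), ModuleCat.ofHom f, inferInstanceAs (Module.Finite A (Fin n → A)),
    inferInstanceAs (Module.Projective A (Fin n → A)), (ModuleCat.epi_iff_surjective _).2 hf⟩

theorem exists_epi_of_extBounded (k : ℕ) (M : ModuleCat.{u} A) [Module.Finite A M] :
    ∃ (X : ModuleCat.{u} A) (f : X ⟶ M), extBounded U k X ∧ Epi f := by
  obtain ⟨X, f, _, _, hf⟩ := exists_epi_of_finite M
  exact ⟨X, f, extBounded_of_projective k X, hf⟩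

variable {V : Type*} [AddCommGroup V] [IsNoetherianRing A]

theorem AdditiveOn.exists_extension_extBounded {m : ModuleCat.{u} A → V}
    (hm : AdditiveOn (extBounded U 0) m) (k : ℕ) :
    ∃ m' : ModuleCat.{u} A → V, AdditiveOn (extBounded U k) m' ∧
      ∀ M, extBounded U 0 M → m' M = m M := by
  induction k with
  | zero => exact ⟨m, hm, fun _ _ => rfl⟩
  | succ k ih =>
    obtain ⟨m', hm', h'⟩ := ih
    obtain ⟨m'', hm'', h''⟩ := hm'.exists_extension (Q := extBounded U (k + 1))
      (extBounded_mono k.le_succ) (fun _ hS => extBounded_X₁ hS)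
      (fun M hM => have := hM.1; exists_epi_of_extBounded k M)
    exact ⟨m'', hm'', fun M hM => (h'' M (extBounded_mono k.zero_le M hM)).trans (h' M hM)⟩

/-- A subgroup containing the values of an additive function on `extBounded U 0` contains its
values on all of `extBounded U k`. -/
theorem AdditiveOn.mem_of_extBounded {m : ModuleCat.{u} A → V}
    (hm : AdditiveOn (fun M : ModuleCat.{u} A => Module.Finite A M) m) (W : AddSubgroup V)
    (hW : ∀ M, extBounded U 0 M → m M ∈ W) (k : ℕ) (M : ModuleCat.{u} A)
    (hM : extBounded U k M) : m M ∈ W := by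
  induction k generalizing M with
  | zero => exact hW M hM
  | succ k ih =>
    have := hM.1
    obtain ⟨X, f, hX, hf⟩ := exists_epi_of_extBounded (U := U) k M
    have hK := extBounded_X₁ (shortExact_kernel f) hX hM
    have h := hm _ (shortExact_kernel f) hK.1 hX.1 hM.1
    dsimp only at h
    rw [show m M = m X - m (kernel f) by rw [h, add_sub_cancel_left]]
    exact W.sub_mem (ih _ hX) (ih _ hK)

end ExtBounded

/-! ### Additive functions on modules of finite length -/

section FiniteLength

variable {A : Type u} [Ring A] {V : Type*} [AddCommGroup V]

theorem shortExact_of_exact {N M L : Type u} [AddCommGroup N] [Module A N] [AddCommGroup M]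
    [Module A M] [AddCommGroup L] [Module A L] {f : N →ₗ[A] M} {g : M →ₗ[A] L}
    (hf : Function.Injective f) (hg : Function.Surjective g) (h : Function.Exact f g) :
    (ShortComplex.mk (ModuleCat.ofHom f) (ModuleCat.ofHom g)
      (ModuleCat.hom_ext h.linearMap_comp_eq_zero)).ShortExact where
  exact := (ShortComplex.ShortExact.moduleCat_exact_iff_function_exact _).2 h
  mono_f := (ModuleCat.mono_iff_injective _).2 hf
  epi_g := (ModuleCat.epi_iff_surjective _).2 hg

theorem isFiniteLength_of_finite [IsArtinianRing A] (M : Type u) [AddCommGroup M] [Module A M]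
    [Module.Finite A M] : IsFiniteLength A M :=
  isFiniteLength_iff_isNoetherian_isArtinian.2 ⟨inferInstance, inferInstance⟩

instance : ObjectProperty.ContainsZero (fun M : ModuleCat.{u} A => Module.Finite A M) where
  exists_zero := ⟨ModuleCat.of A PUnit.{u + 1}, ModuleCat.isZero_of_subsingleton _,
    inferInstanceAs (Module.Finite A PUnit.{u + 1})⟩

/-- A subgroup containing the values of an additive function on the simple modules contains all its
values. -/
theorem AdditiveOn.mem_of_simple [IsArtinianRing A] {m : ModuleCat.{u} A → V}
    (hm : AdditiveOn (fun M : ModuleCat.{u} A => Module.Finite A M) m) (W : AddSubgroup V)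
    (h : ∀ M : ModuleCat.{u} A, IsSimpleModule A M → m M ∈ W) (M : ModuleCat.{u} A)
    [Module.Finite A M] : m M ∈ W := by
  suffices H : ∀ (N : Type u) [AddCommGroup N] [Module A N], IsFiniteLength A N →
      m (ModuleCat.of A N) ∈ W from H M (isFiniteLength_of_finite M)
  intro N _ _ hN
  induction hN with
  | of_subsingleton =>
    rw [hm.map_isZero (ModuleCat.isZero_of_subsingleton _) Module.Finite.of_finite]
    exact W.zero_mem
  | @of_simple_quotient M _ _ N _ hN ih =>
    have hM := (IsFiniteLength.of_simple_quotient hN)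
    have := (isFiniteLength_iff_isNoetherian_isArtinian.1 hM).1
    have := (isFiniteLength_iff_isNoetherian_isArtinian.1 hN).1
    have e := hm _ (shortExact_of_exact N.injective_subtype N.mkQ_surjective
      (LinearMap.exact_subtype_mkQ N)) (inferInstanceAs (Module.Finite A N))
      (inferInstanceAs (Module.Finite A M)) (inferInstanceAs (Module.Finite A (M ⧸ N)))
    dsimp only at e
    rw [e]
    exact W.add_mem ih (h _ ‹_›)

theorem AdditiveOn.homLength [IsArtinianRing A] (P : Type*) [AddCommGroup P] [Module A P]
    [Module.Projective A P] :
    AdditiveOn (fun M : ModuleCat.{u} A => Module.Finite A M)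
      (fun M => ((homLength (A := A) P M).toNat : ℚ)) := by
  intro S hS h₁ h₂ h₃
  have := homLength_eq_add P hS.moduleCat_injective_f hS.moduleCat_surjective_g
    ((ShortComplex.ShortExact.moduleCat_exact_iff_function_exact S).1 hS.exact)
  dsimp only
  -- Finiteness matters here: `toNat` sends `⊤` to `0` and is not additive in general.
  rw [this, ENat.toNat_add (homLength_ne_top P (isFiniteLength_of_finite _))
    (homLength_ne_top P (isFiniteLength_of_finite _)), Nat.cast_add]

end FiniteLength

/-! ### The exact category inside the module category: series, projectives, indecomposables -/

section PerpRealization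

variable {A : Type u} [Ring A] {C : Type u'} [Category.{v'} C] [Preadditive C] [HasZeroObject C]
  [HasBinaryBiproducts C]

/-- A functor to modules which identifies the exact category `𝓔` with the extension-closed
subcategory of the finitely generated modules `X` such that `Extⁱ(X, U) = 0` for `i > 0`. -/
structure IsPerpRealization (𝓔 : ExactStructure C) (G : C ⥤ ModuleCat.{u} A) [G.Additive]
    (U : ModuleCat.{u} A) : Prop where
  conflation_iff : ∀ S : ShortComplex C, 𝓔.conflation S ↔ (S.map G).ShortExact
  mem : ∀ X : C, extBounded U 0 (G.obj X)
  exists_iso : ∀ M : ModuleCat.{u} A, extBounded U 0 M → ∃ X : C, Nonempty (G.obj X ≅ M)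

namespace IsPerpRealization

variable {𝓔 : ExactStructure C} {G : C ⥤ ModuleCat.{u} A} [G.Additive]
  {U : ModuleCat.{u} A}

theorem finite (h : IsPerpRealization 𝓔 G U) (X : C) : Module.Finite A (G.obj X) := (h.mem X).1

theorem conflation_iff_exact (h : IsPerpRealization 𝓔 G U) {X Y Z : C} (f : X ⟶ Y) (g : Y ⟶ Z)
    (w : f ≫ g = 0) : 𝓔.conflation (ShortComplex.mk f g w) ↔
      Function.Injective (G.map f).hom ∧ Function.Surjective (G.map g).hom ∧
        Function.Exact (G.map f).hom (G.map g).hom := by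
  rw [h.conflation_iff]
  constructor
  · intro hS
    exact ⟨hS.moduleCat_injective_f, hS.moduleCat_surjective_g,
      (ShortComplex.ShortExact.moduleCat_exact_iff_function_exact _).1 hS.exact⟩
  · rintro ⟨h1, h2, h3⟩
    exact
      { exact := (ShortComplex.ShortExact.moduleCat_exact_iff_function_exact _).2 h3
        mono_f := (ModuleCat.mono_iff_injective _).2 h1
        epi_g := (ModuleCat.epi_iff_surjective _).2 h2 }

theorem apply_add {V : Type*} [AddCommGroup V] {m : ModuleCat.{u} A → V}
    (h : IsPerpRealization 𝓔 G U)
    (hm : AdditiveOn (fun M : ModuleCat.{u} A => Module.Finite A M) m) {S : ShortComplex C}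
    (hS : 𝓔.conflation S) : m (G.obj S.X₂) = m (G.obj S.X₁) + m (G.obj S.X₃) :=
  hm _ ((h.conflation_iff S).1 hS) (h.finite _) (h.finite _) (h.finite _)

omit [HasZeroObject C] [HasBinaryBiproducts C] in
theorem isZero_iff [G.Faithful] {X : C} : IsZero X ↔ Subsingleton (G.obj X) := by
  constructor
  · intro hX
    exact ModuleCat.subsingleton_of_isZero (G.map_isZero hX)
  · intro hX
    rw [IsZero.iff_id_eq_zero]
    exact G.map_injective ((ModuleCat.isZero_of_subsingleton _).eq_of_src _ _)

section Length

variable [IsArtinianRing A]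

theorem length_ne_top (h : IsPerpRealization 𝓔 G U) (X : C) :
    Module.length A (G.obj X) ≠ ⊤ :=
  have := h.finite X
  Module.length_ne_top

theorem length_add (h : IsPerpRealization 𝓔 G U) {S : ShortComplex C} (hS : 𝓔.conflation S) :
    (Module.length A (G.obj S.X₂)).toNat =
      (Module.length A (G.obj S.X₁)).toNat + (Module.length A (G.obj S.X₃)).toNat := by
  obtain ⟨h1, h2, h3⟩ := (h.conflation_iff_exact S.f S.g S.zero).1 hS
  rw [Module.length_eq_add_of_exact _ _ h1 h2 h3,
    ENat.toNat_add (h.length_ne_top _) (h.length_ne_top _)]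

theorem length_pos [G.Faithful] (h : IsPerpRealization 𝓔 G U) {X : C} (hX : ¬ IsZero X) :
    0 < (Module.length A (G.obj X)).toNat := by
  rw [isZero_iff (G := G), ← Module.length_eq_zero_iff (R := A)] at hX
  rw [Nat.pos_iff_ne_zero, Ne, ENat.toNat_eq_zero]
  exact not_or.2 ⟨hX, h.length_ne_top X⟩

/-- Each proper inflation has a nonzero quotient, because the kernel of a map to zero is an
isomorphism; so module length grows at every step. -/
theorem length_le (h : IsPerpRealization 𝓔 G U) [G.Faithful] {X : C} (s : 𝓔.InflationSeries X)
    (hs : s.IsProper) : s.length ≤ (Module.length A (G.obj X)).toNat := by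
  induction s with
  | zero X hX => exact Nat.zero_le _
  | snoc S hS s ih =>
    have h3 : ¬ IsZero S.X₃ := by
      intro h0
      obtain ⟨c⟩ := 𝓔.isKernel hS
      obtain ⟨l, hl⟩ := KernelFork.IsLimit.lift' c (𝟙 S.X₂) (h0.eq_of_tgt _ _)
      dsimp at hl
      exact hs.1 ⟨l, Fork.IsLimit.hom_ext c (by simp [Category.assoc, hl]), hl⟩
    rw [h.length_add hS]
    exact Nat.add_le_add (ih hs.2) (h.length_pos h3)

theorem isLength (h : IsPerpRealization 𝓔 G U) [G.Faithful] : 𝓔.IsLength := fun _ =>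
  ⟨_, h.length_le⟩

end Length

end IsPerpRealization

namespace ExactStructure.InflationSeries

variable {𝓔 : ExactStructure C}

theorem exists_factors_eq_of_iso {X Y : C} (e : X ≅ Y) (s : 𝓔.InflationSeries X) :
    ∃ t : 𝓔.InflationSeries Y, t.factors = s.factors := by
  cases s with
  | zero _ h => exact ⟨zero Y (h.of_iso e.symm), rfl⟩
  | snoc S h s =>
    let T : ShortComplex C := ShortComplex.mk (S.f ≫ e.hom) (e.inv ≫ S.g) (by simp)
    have hT : 𝓔.conflation T := 𝓔.of_iso (ShortComplex.isoMk (S₁ := S) (S₂ := T) (Iso.refl _) e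
      (Iso.refl _) (by simp [T]) (by simp [T])) h
    exact ⟨snoc T hT s, rfl⟩

theorem exists_factors_eq_singleton {X : C} : ∃ s : 𝓔.InflationSeries X, s.factors = [X] := by
  obtain ⟨K, f, w, hS⟩ := 𝓔.deflation_id X
  have hK : IsZero K := by
    obtain ⟨c⟩ := 𝓔.isKernel hS
    have hf : f = 0 := by simpa using w
    rw [IsZero.iff_id_eq_zero]
    exact Fork.IsLimit.hom_ext c (by simp [hf])
  exact ⟨snoc _ hS (zero K hK), rfl⟩

end ExactStructure.InflationSeries

namespace IsPerpRealization

variable {𝓔 : ExactStructure C} {G : C ⥤ ModuleCat.{u} A} [G.Additive]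
  {U : ModuleCat.{u} A}

open ExactStructure InflationSeries

/-- A series of `Z` is pulled back along `g` and stacked on the series of `X`; the quotients are
unchanged by the third isomorphism theorem. -/
theorem exists_factors_append (h : IsPerpRealization 𝓔 G U) {Z : C} (t : 𝓔.InflationSeries Z)
    {X Y : C} (f : X ⟶ Y) (g : Y ⟶ Z) (w : f ≫ g = 0) (hS : 𝓔.conflation (ShortComplex.mk f g w))
    (s : 𝓔.InflationSeries X) :
    ∃ r : 𝓔.InflationSeries Y, r.factors = t.factors ++ s.factors := by
  induction t generalizing X Y with
  | zero Z hZ =>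
    obtain ⟨c⟩ := 𝓔.isKernel hS
    obtain ⟨l, hl⟩ := KernelFork.IsLimit.lift' c (𝟙 Y) (hZ.eq_of_tgt _ _)
    dsimp at hl
    let e : X ≅ Y := ⟨f, l, Fork.IsLimit.hom_ext c (by simp [Category.assoc, hl]), hl⟩
    exact exists_factors_eq_of_iso e s
  | snoc T hT t ih =>
    -- `K` is the preimage in `Y` of the last proper stage `T.X₁` of the series of `Z`. It is an
    -- extension of `T.X₁` by `X`, to which the induction hypothesis applies.
    obtain ⟨K, k, wk, hK⟩ := 𝓔.deflation_comp g T.g ⟨_, f, w, hS⟩ ⟨_, T.f, T.zero, hT⟩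
    obtain ⟨cK⟩ := 𝓔.isKernel hK
    obtain ⟨cT⟩ := 𝓔.isKernel hT
    obtain ⟨a, ha⟩ := KernelFork.IsLimit.lift' cK f (by simp [← Category.assoc, w])
    obtain ⟨p, hp⟩ := KernelFork.IsLimit.lift' cT (k ≫ g) (by simpa using wk)
    dsimp at ha hp
    have wap : a ≫ p = 0 := Fork.IsLimit.hom_ext cT (by simp [hp, reassoc_of% ha, w])
    obtain ⟨f1, g2, fg⟩ := (h.conflation_iff_exact _ _ _).1 hS
    obtain ⟨k1, -, kq⟩ := (h.conflation_iff_exact _ _ _).1 hK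
    obtain ⟨t1, t2, tt⟩ := (h.conflation_iff_exact T.f T.g T.zero).1 hT
    have ha' : ∀ x, (G.map k).hom ((G.map a).hom x) = (G.map f).hom x := fun x => by
      rw [← ha, G.map_comp]; rfl
    have hp' : ∀ x, (G.map T.f).hom ((G.map p).hom x) = (G.map g).hom ((G.map k).hom x) :=
      fun x => by
        have := congrArg (fun φ => (G.map φ).hom x) hp
        simpa using this
    have hc : 𝓔.conflation (ShortComplex.mk a p wap) := by
      refine (h.conflation_iff_exact _ _ _).2 ⟨?_, ?_, ?_⟩
      · intro x y hxy
        exact f1 (by rw [← ha', ← ha', hxy])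
      · intro z
        obtain ⟨y, hy⟩ := g2 ((G.map T.f).hom z)
        have hy0 : (G.map (g ≫ T.g)).hom y = 0 := by
          rw [G.map_comp]
          change (G.map T.g).hom ((G.map g).hom y) = 0
          rw [hy]
          exact (tt _).2 ⟨z, rfl⟩
        obtain ⟨x, rfl⟩ := (kq y).1 hy0
        exact ⟨x, t1 (by rw [hp', hy])⟩
      · intro x
        constructor
        · intro hx
          have h0 : (G.map g).hom ((G.map k).hom x) = 0 := by rw [← hp', hx, map_zero]
          obtain ⟨y, hy⟩ := (fg _).1 h0
          exact ⟨y, k1 (by rw [ha', hy])⟩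
        · rintro ⟨y, rfl⟩
          exact t1 (by rw [hp', ha', map_zero]; exact (fg _).2 ⟨y, rfl⟩)
    obtain ⟨r, hr⟩ := ih a p wap hc s
    exact ⟨snoc _ hK r, congrArg (T.X₃ :: ·) hr⟩

/-- Induction on module length: a nonzero object that is not simple is the middle of a conflation
with strictly shorter ends, whose series are concatenated. -/
theorem exists_isComposition [IsArtinianRing A] [G.Faithful] (h : IsPerpRealization 𝓔 G U)
    (X : C) : ∃ s : 𝓔.InflationSeries X, s.IsComposition := by
  induction hn : (Module.length A (G.obj X)).toNat using Nat.strong_induction_on generalizing X with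
  | _ n ih =>
    by_cases hX : IsZero X
    · exact ⟨zero X hX, fun Q hQ => absurd hQ List.not_mem_nil⟩
    by_cases hs : 𝓔.IsSimple X
    · obtain ⟨s, hs'⟩ := exists_factors_eq_singleton (𝓔 := 𝓔) (X := X)
      refine ⟨s, fun Q hQ => ?_⟩
      rw [hs', List.mem_singleton] at hQ
      exact hQ ▸ hs
    · simp only [ExactStructure.IsSimple, hX, not_false_eq_true, true_and, not_forall, not_or] at hs
      obtain ⟨S, hS, ⟨e⟩, h1, h3⟩ := hs
      have hl := h.length_add hS
      have he : (Module.length A (G.obj S.X₂)).toNat = n := by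
        rw [← hn, (G.mapIso e).toLinearEquiv.length_eq]
      have p1 := h.length_pos h1
      have p3 := h.length_pos h3
      obtain ⟨s, hs⟩ := ih _ (by omega) S.X₁ rfl
      obtain ⟨t, ht⟩ := ih _ (by omega) S.X₃ rfl
      obtain ⟨r, hr⟩ := h.exists_factors_append t S.f S.g S.zero hS s
      obtain ⟨r', hr'⟩ := exists_factors_eq_of_iso e r
      refine ⟨r', fun Q hQ => ?_⟩
      rw [hr', hr, List.mem_append] at hQ
      exact hQ.elim (ht Q) (hs Q)

section Projective

variable [G.Full] [G.Faithful]

/-- A finitely generated projective cover-map onto `G.obj X` has its kernel in the subcategory by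
dimension shift, so it is a deflation there and splits when `X` is projective. Conversely,
deflations are surjective and `G` is full. -/
theorem isProjective_iff [IsNoetherianRing A] (h : IsPerpRealization 𝓔 G U) (X : C) :
    𝓔.IsProjective X ↔ Module.Projective A (G.obj X) := by
  have := h.finite X
  constructor
  · intro hX
    obtain ⟨M, f, _, _, hf⟩ := exists_epi_of_finite (G.obj X)
    obtain ⟨Y, ⟨eY⟩⟩ := h.exists_iso M (extBounded_of_projective 0 M)
    have hK : extBounded U 0 (kernel f) := extBounded_X₁ (shortExact_kernel f)
      (extBounded_of_projective 0 M) (extBounded_mono (Nat.zero_le 1) _ (h.mem X))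
    obtain ⟨K, ⟨eK⟩⟩ := h.exists_iso _ hK
    let k : K ⟶ Y := G.preimage (eK.hom ≫ kernel.ι f ≫ eY.inv)
    let g : Y ⟶ X := G.preimage (eY.hom ≫ f)
    have w : k ≫ g = 0 := G.map_injective (by simp [k, g])
    have hc : 𝓔.conflation (ShortComplex.mk k g w) := by
      rw [h.conflation_iff]
      refine ShortComplex.shortExact_of_iso (ShortComplex.isoMk
        (S₁ := ShortComplex.mk (kernel.ι f) f (kernel.condition f))
        (S₂ := (ShortComplex.mk k g w).map G) eK.symm eY.symm (Iso.refl _)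
        ?_ ?_) (shortExact_kernel f)
      · change eK.inv ≫ G.map k = kernel.ι f ≫ eY.inv
        rw [G.map_preimage, Iso.inv_hom_id_assoc]
      · change eY.inv ≫ G.map g = f ≫ 𝟙 _
        rw [G.map_preimage, Iso.inv_hom_id_assoc, Category.comp_id]
    obtain ⟨l, hl⟩ := hX _ hc (𝟙 X)
    have hG : (G.map l ≫ eY.hom) ≫ f = 𝟙 _ := by
      have := congrArg G.map hl
      simpa [g] using this
    exact Module.Projective.of_split (G.map l ≫ eY.hom).hom f.hom (congrArg ModuleCat.Hom.hom hG)
  · intro hX S hS f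
    obtain ⟨-, h2, -⟩ := (h.conflation_iff_exact S.f S.g S.zero).1 hS
    obtain ⟨l, hl⟩ := Module.projective_lifting_property (G.map S.g).hom (G.map f).hom h2
    refine ⟨G.preimage (ModuleCat.ofHom l), G.map_injective ?_⟩
    rw [G.map_comp, G.map_preimage]
    exact ModuleCat.hom_ext hl

/-- Direct summands of the projective module `G.obj X` are projective, hence come from objects of
`C`; indecomposability in `C` therefore excludes decompositions as a module. -/
theorem fittingDichotomy [IsArtinianRing A] (h : IsPerpRealization 𝓔 G U) {X : C}
    (hi : Indecomposable X) (hp : 𝓔.IsProjective X) : FittingDichotomy A (G.obj X) := by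
  have := h.finite X
  have := (h.isProjective_iff X).1 hp
  refine fittingDichotomy_of_isCompl fun N₁ N₂ hN => ?_
  let e := Submodule.prodEquivOfIsCompl N₁ N₂ hN
  have : Module.Projective A (N₁ × N₂) := Module.Projective.of_equiv e.symm
  have : Module.Projective A N₁ :=
    Module.Projective.of_split (LinearMap.inl A N₁ N₂) (LinearMap.fst A N₁ N₂) rfl
  have : Module.Projective A N₂ :=
    Module.Projective.of_split (LinearMap.inr A N₁ N₂) (LinearMap.snd A N₁ N₂) rfl
  obtain ⟨X₁, ⟨e₁⟩⟩ := h.exists_iso (ModuleCat.of A N₁)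
    (@extBounded_of_projective A _ U 0 _ (inferInstanceAs (Module.Finite A N₁)) ‹_›)
  obtain ⟨X₂, ⟨e₂⟩⟩ := h.exists_iso (ModuleCat.of A N₂)
    (@extBounded_of_projective A _ U 0 _ (inferInstanceAs (Module.Finite A N₂)) ‹_›)
  have := preservesBinaryBiproducts_of_preservesBiproducts G
  let i : G.obj X ≅ G.obj (X₁ ⊞ X₂) := e.symm.toModuleIso ≪≫
    (ModuleCat.biprodIsoProd (ModuleCat.of A N₁) (ModuleCat.of A N₂)).symm ≪≫
    biprod.mapIso e₁.symm e₂.symm ≪≫ (G.mapBiprod X₁ X₂).symm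
  refine (hi.2 X₁ X₂ (G.preimageIso i)).imp (fun hz => ?_) (fun hz => ?_)
  · have := isZero_iff (G := G).1 hz
    have : Subsingleton N₁ := e₁.toLinearEquiv.symm.toEquiv.subsingleton
    exact Submodule.eq_bot_of_subsingleton
  · have := isZero_iff (G := G).1 hz
    have : Subsingleton N₂ := e₂.toLinearEquiv.symm.toEquiv.subsingleton
    exact Submodule.eq_bot_of_subsingleton

/-- Take a projective of least length with a nonzero map to `S`, starting from the regular module.
If it decomposed, the map would vanish on both shorter summands, hence altogether. -/
theorem exists_indecomposable_isProjective [IsArtinianRing A] (h : IsPerpRealization 𝓔 G U)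
    (S : Type u) [AddCommGroup S] [Module A S] [IsSimpleModule A S] :
    ∃ X : C, Indecomposable X ∧ 𝓔.IsProjective X ∧ ∃ f : G.obj X →ₗ[A] S, f ≠ 0 := by
  classical
  have hex : ∃ n : ℕ, ∃ X : C, 𝓔.IsProjective X ∧ (∃ f : G.obj X →ₗ[A] S, f ≠ 0) ∧
      (Module.length A (G.obj X)).toNat = n := by
    obtain ⟨X, ⟨e⟩⟩ := h.exists_iso (ModuleCat.of A A)
      (@extBounded_of_projective A _ U 0 _ (inferInstanceAs (Module.Finite A A))
        (inferInstanceAs (Module.Projective A A)))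
    refine ⟨_, X, (h.isProjective_iff X).2 ?_, ?_, rfl⟩
    · have : Module.Projective A (ModuleCat.of A A) := inferInstanceAs (Module.Projective A A)
      exact Module.Projective.of_equiv e.toLinearEquiv.symm
    · have := IsSimpleModule.nontrivial A S
      obtain ⟨s, hs⟩ := exists_ne (0 : S)
      refine ⟨LinearMap.toSpanSingleton A S s ∘ₗ e.hom.hom, fun h0 => hs ?_⟩
      have := LinearMap.congr_fun h0 (e.inv.hom (1 : A))
      simpa using this
  obtain ⟨X, hX, ⟨f, hf⟩, hn⟩ := Nat.find_spec hex
  have hmin : ∀ Y : C, 𝓔.IsProjective Y → (∃ f : G.obj Y →ₗ[A] S, f ≠ 0) →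
      (Module.length A (G.obj X)).toNat ≤ (Module.length A (G.obj Y)).toNat := fun Y h1 h2 =>
    hn ▸ Nat.find_min' hex ⟨Y, h1, h2, rfl⟩
  refine ⟨X, ⟨fun hz => hf ?_, fun Y Z e => ?_⟩, hX, f, hf⟩
  · have := isZero_iff (G := G).1 hz
    exact LinearMap.ext fun x => by rw [Subsingleton.elim x 0, map_zero, map_zero]
  have hproj : ∀ {W : C} (i : W ⟶ X) (p : X ⟶ W), i ≫ p = 𝟙 W → 𝓔.IsProjective W := by
    intro W i p hip T hT a
    obtain ⟨l, hl⟩ := hX T hT (p ≫ a)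
    exact ⟨i ≫ l, by rw [Category.assoc, hl, ← Category.assoc, hip, Category.id_comp]⟩
  have hY : 𝓔.IsProjective Y := hproj (biprod.inl ≫ e.inv) (e.hom ≫ biprod.fst) (by simp)
  have hZ : 𝓔.IsProjective Z := hproj (biprod.inr ≫ e.inv) (e.hom ≫ biprod.snd) (by simp)
  let T : ShortComplex C := ShortComplex.mk (biprod.inl : Y ⟶ Y ⊞ Z) biprod.snd (by simp)
  have hT : 𝓔.conflation T := by
    rw [h.conflation_iff]
    let sp : T.Splitting :=
      { r := biprod.fst, s := biprod.inr, f_r := by simp [T], s_g := by simp [T],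
        id := by simp [T] }
    exact (sp.map G).shortExact
  have hl := h.length_add hT
  have he : (Module.length A (G.obj T.X₂)).toNat = (Module.length A (G.obj X)).toNat := by
    rw [(G.mapIso e).toLinearEquiv.length_eq]
  by_contra hc
  obtain ⟨hzY, hzZ⟩ := not_or.1 hc
  have pY := h.length_pos hzY
  have pZ := h.length_pos hzZ
  dsimp only [T] at hl he
  have fY : f ∘ₗ (G.map (biprod.inl ≫ e.inv)).hom = 0 := by
    by_contra hne
    have := hmin Y hY ⟨_, hne⟩
    omega
  have fZ : f ∘ₗ (G.map (biprod.inr ≫ e.inv)).hom = 0 := by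
    by_contra hne
    have := hmin Z hZ ⟨_, hne⟩
    omega
  refine hf ?_
  have hid : 𝟙 X = (e.hom ≫ biprod.fst) ≫ (biprod.inl ≫ e.inv) +
      (e.hom ≫ biprod.snd) ≫ (biprod.inr ≫ e.inv) := by
    have : e.hom ≫ (biprod.fst ≫ biprod.inl + biprod.snd ≫ biprod.inr) ≫ e.inv = 𝟙 X := by
      simp [biprod.total]
    refine this.symm.trans ?_
    simp only [Preadditive.add_comp, Preadditive.comp_add, Category.assoc]
  ext x
  have hx : x = (G.map (𝟙 X)).hom x := by simp
  rw [hx, hid, G.map_add, G.map_comp, G.map_comp _ (biprod.inr ≫ e.inv)]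
  have y1 := LinearMap.congr_fun fY ((G.map (e.hom ≫ biprod.fst)).hom x)
  have y2 := LinearMap.congr_fun fZ ((G.map (e.hom ≫ biprod.snd)).hom x)
  rw [LinearMap.comp_apply, LinearMap.zero_apply] at y1 y2
  rw [ModuleCat.hom_add, LinearMap.add_apply, map_add, ModuleCat.hom_comp, ModuleCat.hom_comp,
    LinearMap.comp_apply, LinearMap.comp_apply, y1, y2, add_zero, LinearMap.zero_apply]

end Projective

end IsPerpRealization

end PerpRealization

/-! ### Inflation series as formal sums of classes -/

section ClassSum

variable {C : Type u'} [Category.{v'} C] [Preadditive C] [HasZeroObject C]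
  [HasBinaryBiproducts C] {𝓔 : ExactStructure C}

namespace ExactStructure.InflationSeries

/-- The formal sum of the isomorphism classes of the factors of an inflation series. -/
noncomputable def classSum {X : C} (s : 𝓔.InflationSeries X) :
    Quotient (isIsomorphicSetoid C) →₀ ℚ :=
  (s.factors.map fun Q => Finsupp.single (Quotient.mk (isIsomorphicSetoid C) Q) 1).sum

theorem classSum_eq_sum {X : C} (s : 𝓔.InflationSeries X) :
    s.classSum = ∑ i : Fin s.factors.length,
      Finsupp.single (Quotient.mk (isIsomorphicSetoid C) (s.factors.get i)) 1 :=
  (Fin.sum_univ_fun_getElem s.factors _).symm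

/-- The coefficient of a class counts the indices whose factor lies in it, faithfully since `ℚ` has
characteristic zero; fibres of equal size assemble into a bijection of indices. -/
theorem isomorphic_iff_classSum_eq {X Y : C} (s : 𝓔.InflationSeries X)
    (t : 𝓔.InflationSeries Y) : s.Isomorphic t ↔ s.classSum = t.classSum := by
  classical
  rw [classSum_eq_sum, classSum_eq_sum]
  constructor
  · rintro ⟨σ, hσ⟩
    refine Fintype.sum_equiv σ _ _ fun i => ?_
    rw [Quotient.sound (s := isIsomorphicSetoid C) (hσ i)]
  · intro h
    let f : Fin s.factors.length → Quotient (isIsomorphicSetoid C) :=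
      fun i => Quotient.mk _ (s.factors.get i)
    let g : Fin t.factors.length → Quotient (isIsomorphicSetoid C) :=
      fun i => Quotient.mk _ (t.factors.get i)
    have hc : ∀ q, Fintype.card {i // f i = q} = Fintype.card {i // g i = q} := fun q => by
      have := DFunLike.congr_fun h q
      simp only [Finsupp.coe_finsetSum, Finset.sum_apply, Finsupp.single_apply,
        Finset.sum_boole, Nat.cast_inj] at this
      rw [Fintype.card_subtype, Fintype.card_subtype]
      exact this
    let e := fun q => Fintype.equivOfCardEq (hc q)
    exact ⟨Equiv.ofFiberEquiv e, fun i => Quotient.exact (Equiv.ofFiberEquiv_map e i).symm⟩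

end ExactStructure.InflationSeries

end ClassSum

/-! ### Comparing simple objects with indecomposable projectives -/

section Counting

variable {A : Type u} [Ring A] {C : Type u'} [Category.{v'} C] [Preadditive C] [HasZeroObject C]
  [HasBinaryBiproducts C]

theorem exists_simple_quotient (M : ModuleCat.{u} A) [Module.Finite A M] [Nontrivial M] :
    ∃ (S : ModuleCat.{u} A) (f : M →ₗ[A] S), IsSimpleModule A S ∧ f ≠ 0 := by
  obtain ⟨N, hN⟩ := IsCoatomic.exists_coatom (Submodule A M)
  have hs := isSimpleModule_iff_isCoatom.2 hN
  refine ⟨ModuleCat.of A (M ⧸ N), N.mkQ, hs, fun h0 => hN.1 ?_⟩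
  rw [← N.ker_mkQ, h0, LinearMap.ker_zero]

namespace IsPerpRealization

open ExactStructure InflationSeries

variable {𝓔 : ExactStructure C} {G : C ⥤ ModuleCat.{u} A} [G.Additive]
  {U : ModuleCat.{u} A}

theorem apply_eq_sum_factors {V : Type*} [AddCommGroup V] {m : ModuleCat.{u} A → V}
    (h : IsPerpRealization 𝓔 G U)
    (hm : AdditiveOn (fun M : ModuleCat.{u} A => Module.Finite A M) m) {X : C}
    (s : 𝓔.InflationSeries X) : m (G.obj X) = (s.factors.map fun Q => m (G.obj Q)).sum := by
  induction s with
  | zero X hX => exact hm.map_isZero (G.map_isZero hX) (h.finite X)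
  | snoc S hS s ih =>
    rw [h.apply_add hm hS, ih, add_comm]
    exact List.sum_cons.symm

variable [G.Full] [G.Faithful] [IsArtinianRing A]

/-- The isomorphism classes of indecomposable projective objects index the simple modules and their
multiplicities as composition factors. -/
theorem exists_multiplicity [DecidableEq 𝓔.indecProjectiveClasses]
    (h : IsPerpRealization 𝓔 G U) :
    ∃ (S : 𝓔.indecProjectiveClasses → ModuleCat.{u} A)
      (d : ModuleCat.{u} A → 𝓔.indecProjectiveClasses → ℚ),
      (∀ j, IsSimpleModule A (S j)) ∧
      (∀ M : ModuleCat.{u} A, IsSimpleModule A M → ∃ j, Nonempty (M ≅ S j)) ∧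
      AdditiveOn (fun M : ModuleCat.{u} A => Module.Finite A M) d ∧
      (∀ j, d (S j) = Pi.single j 1) ∧ Finite 𝓔.indecProjectiveClasses := by
  choose X hind hproj hcls using fun j : 𝓔.indecProjectiveClasses => j.2
  have hfin := fun j => h.finite (X j)
  have hmp := fun j => (h.isProjective_iff (X j)).1 (hproj j)
  have hfit := fun j => h.fittingDichotomy (hind j) (hproj j)
  have hnt : ∀ j, Nontrivial (G.obj (X j)) := fun j =>
    not_subsingleton_iff_nontrivial.1 fun hs => (hind j).1 (isZero_iff.2 hs)
  choose S f hS hf using fun j => exists_simple_quotient (G.obj (X j))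
  let d : ModuleCat.{u} A → 𝓔.indecProjectiveClasses → ℚ := fun M j =>
    ((homLength (A := A) (G.obj (X j)) M).toNat : ℚ)
  have hd : AdditiveOn (fun M : ModuleCat.{u} A => Module.Finite A M) d :=
    fun T hT h₁ h₂ h₃ => funext fun j => AdditiveOn.homLength (G.obj (X j)) T hT h₁ h₂ h₃
  have hS' : ∀ M : ModuleCat.{u} A, IsSimpleModule A M → ∃ j, Nonempty (M ≅ S j) := by
    intro M hM
    obtain ⟨Y, hY, hYp, g, hg⟩ := h.exists_indecomposable_isProjective M
    let j : 𝓔.indecProjectiveClasses := ⟨Quotient.mk _ Y, Y, hY, hYp, rfl⟩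
    obtain ⟨e⟩ : Nonempty (X j ≅ Y) := Quotient.exact (hcls j)
    have hne : g ∘ₗ (G.map e.hom).hom ≠ 0 := by
      intro h0
      refine hg (LinearMap.ext fun y => ?_)
      have := LinearMap.congr_fun h0 ((G.map e.inv).hom y)
      rw [LinearMap.comp_apply, ← LinearMap.comp_apply (G.map e.hom).hom, ← ModuleCat.hom_comp,
        ← G.map_comp, e.inv_hom_id, G.map_id] at this
      exact this
    obtain ⟨i⟩ := (hfit j).nonempty_linearEquiv_of_simple hne (hf j)
    exact ⟨j, ⟨i.toModuleIso⟩⟩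
  have hdS : ∀ j, d (S j) = Pi.single j 1 := by
    intro j
    ext i
    by_cases hij : i = j
    · subst hij
      simp [d, homLength_eq_one _ (hf i)]
    · rw [Pi.single_eq_of_ne hij]
      change ((homLength (A := A) (G.obj (X i)) (S j)).toNat : ℚ) = 0
      rw [homLength_eq_zero]
      · simp
      · intro g
        by_contra hg
        -- A nonzero map from `X i` to `S j` would make `X i` and `X j` projective covers of the
        -- same simple module.
        obtain ⟨e⟩ := (hfit i).nonempty_linearEquiv (hfit j) hg (hf j)
        refine hij (Subtype.ext ?_)
        rw [← hcls i, ← hcls j]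
        exact Quotient.sound (s := isIsomorphicSetoid C) ⟨G.preimageIso e.toModuleIso⟩
  refine ⟨S, d, hS, hS', hd, hdS, ?_⟩
  -- Finiteness of the index set: `d` of the regular module has finite support, because simple
  -- modules have unit vectors as values, yet every index lies in that support, because every `S j`
  -- is a quotient of the regular module.
  let W : AddSubgroup (𝓔.indecProjectiveClasses → ℚ) :=
    { carrier := {v | (Function.support v).Finite}
      zero_mem' := by simp
      add_mem' := fun {a b} ha hb => (ha.union hb).subset (Function.support_add a b)
      neg_mem' := fun {a} ha => by simpa using ha }
  have : Module.Finite A (ModuleCat.of A A) := inferInstanceAs (Module.Finite A A)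
  have hA : d (ModuleCat.of A A) ∈ W := by
    refine hd.mem_of_simple W (fun M hM => ?_) _
    obtain ⟨j, ⟨e⟩⟩ := hS' M hM
    have hM' : Module.Finite A M := inferInstance
    have hSj : Module.Finite A (S j) := inferInstance
    rw [hd.map_iso e hM' hSj, hdS]
    exact (Set.finite_singleton j).subset (Pi.support_single_subset)
  refine Set.finite_univ_iff.1 (Set.Finite.subset hA fun j _ => ?_)
  have hSn := IsSimpleModule.nontrivial A (S j)
  obtain ⟨x, hx⟩ := exists_ne (0 : S j)
  let p : A →ₗ[A] S j := LinearMap.toSpanSingleton A (S j) x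
  have hp : p ≠ 0 := fun h0 => hx (by simpa [p] using LinearMap.congr_fun h0 1)
  have hfk : Module.Finite A (LinearMap.ker p) := inferInstance
  have hSj : Module.Finite A (S j) := inferInstance
  have e := congrFun (hd _ (shortExact_of_exact (LinearMap.ker p).injective_subtype
    (LinearMap.surjective_of_ne_zero hp) (LinearMap.exact_subtype_ker_map p)) hfk this hSj) j
  have e1 : d (S j) j = 1 := by rw [hdS, Pi.single_eq_same]
  have e2 : (0 : ℚ) ≤ d (ModuleCat.of A (LinearMap.ker p)) j := Nat.cast_nonneg _
  rw [Function.mem_support]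
  refine ne_of_gt ?_
  calc (0 : ℚ) < d (ModuleCat.of A (LinearMap.ker p)) j + d (S j) j := by rw [e1]; linarith
    _ = _ := e.symm

/-- A function on `𝓔` which is additive on conflations is induced by an additive function on the
category of all finitely generated modules. -/
theorem exists_additiveOn_finite (h : IsPerpRealization 𝓔 G U) (n : ℕ)
    [HasInjectiveDimensionLE U n] {V : Type*} [AddCommGroup V]
    {m : C → V} (hm : ∀ S : ShortComplex C, 𝓔.conflation S → m S.X₂ = m S.X₁ + m S.X₃)
    (hiso : ∀ {X Y : C}, (X ≅ Y) → m X = m Y) :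
    ∃ m' : ModuleCat.{u} A → V,
      AdditiveOn (fun M : ModuleCat.{u} A => Module.Finite A M) m' ∧ ∀ X, m' (G.obj X) = m X := by
  have : Nonempty C := (HasZeroObject.zero (C := C)).nonempty
  choose! X hX using h.exists_iso
  -- Transport `m` to modules along chosen preimages under `G`; fullness turns a short exact
  -- sequence into a conflation of these preimages.
  have hadd : AdditiveOn (extBounded U 0) fun M => m (X M) := by
    intro S hS h₁ h₂ h₃
    obtain ⟨e₁⟩ := hX _ h₁
    obtain ⟨e₂⟩ := hX _ h₂
    obtain ⟨e₃⟩ := hX _ h₃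
    let T : ShortComplex C := ShortComplex.mk (G.preimage (e₁.hom ≫ S.f ≫ e₂.inv))
      (G.preimage (e₂.hom ≫ S.g ≫ e₃.inv)) (G.map_injective (by simp))
    refine hm T ((h.conflation_iff T).2 ?_)
    refine ShortComplex.shortExact_of_iso (ShortComplex.isoMk (S₁ := S) (S₂ := T.map G)
      e₁.symm e₂.symm e₃.symm ?_ ?_) hS
    · change e₁.inv ≫ G.map T.f = S.f ≫ e₂.inv
      rw [G.map_preimage, Iso.inv_hom_id_assoc]
    · change e₂.inv ≫ G.map T.g = S.g ≫ e₃.inv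
      rw [G.map_preimage, Iso.inv_hom_id_assoc]
  obtain ⟨m', hm', he⟩ := hadd.exists_extension_extBounded n
  refine ⟨m', fun S hS h₁ h₂ h₃ => hm' S hS (extBounded_of_hasInjectiveDimensionLE _)
    (extBounded_of_hasInjectiveDimensionLE _) (extBounded_of_hasInjectiveDimensionLE _),
    fun Y => ?_⟩
  rw [he _ (h.mem Y)]
  exact hiso (G.preimageIso (hX _ (h.mem Y)).some)

omit [G.Full] in
/-- In the presence of the Jordan-Hölder property, the multiset of composition factors is additive
on conflations. -/
theorem exists_additive_of_jordanHolder (h : IsPerpRealization 𝓔 G U) (hJ : 𝓔.JordanHolder) :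
    ∃ m : C → (Quotient (isIsomorphicSetoid C) →₀ ℚ),
      (∀ S : ShortComplex C, 𝓔.conflation S → m S.X₂ = m S.X₁ + m S.X₃) ∧
      (∀ {X Y : C}, (X ≅ Y) → m X = m Y) ∧
      ∀ X, 𝓔.IsSimple X → m X = Finsupp.single (Quotient.mk _ X) 1 := by
  choose s hs using h.exists_isComposition
  have key : ∀ {X : C} (t : 𝓔.InflationSeries X), t.IsComposition →
      (s X).classSum = t.classSum := fun {X} t ht =>
    (isomorphic_iff_classSum_eq _ _).1 (hJ.2 X _ _ (hs X) ht)
  refine ⟨fun X => (s X).classSum, fun S hS => ?_, fun {X Y} e => ?_, fun X hX => ?_⟩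
  · obtain ⟨r, hr⟩ := h.exists_factors_append (s S.X₃) S.f S.g S.zero hS (s S.X₁)
    have hrc : r.IsComposition := fun Q hQ => by
      rw [hr, List.mem_append] at hQ
      exact hQ.elim (hs _ Q) (hs _ Q)
    change (s S.X₂).classSum = (s S.X₁).classSum + (s S.X₃).classSum
    rw [key r hrc, classSum, hr, List.map_append, List.sum_append, add_comm]
    rfl
  · obtain ⟨t, ht⟩ := exists_factors_eq_of_iso e (s X)
    have htc : t.IsComposition := fun Q hQ => hs X Q (ht ▸ hQ)
    change (s X).classSum = (s Y).classSum
    rw [key t htc, classSum, classSum, ht]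
  · obtain ⟨t, ht⟩ := exists_factors_eq_singleton (𝓔 := 𝓔) (X := X)
    have htc : t.IsComposition := fun Q hQ => by
      rw [ht, List.mem_singleton] at hQ
      exact hQ ▸ hX
    change (s X).classSum = _
    rw [key t htc, classSum, ht, List.map_singleton, List.sum_singleton]

theorem jordanHolder_iff (h : IsPerpRealization 𝓔 G U) (n : ℕ) [HasInjectiveDimensionLE U n] :
    𝓔.JordanHolder ↔
      Cardinal.mk 𝓔.simpleClasses = Cardinal.mk 𝓔.indecProjectiveClasses := by
  classical
  obtain ⟨S, d, hS, hS', hd, hdS, hJ⟩ := h.exists_multiplicity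
  have := Fintype.ofFinite 𝓔.indecProjectiveClasses
  choose T hT hcls using fun k : 𝓔.simpleClasses => k.2
  have hclass : ∀ (Q : C) (hQ : 𝓔.IsSimple Q), d (G.obj Q) =
      d (G.obj (T ⟨Quotient.mk _ Q, Q, hQ, rfl⟩)) := fun Q hQ => by
    obtain ⟨e⟩ : Nonempty (T ⟨Quotient.mk _ Q, Q, hQ, rfl⟩ ≅ Q) :=
      Quotient.exact (hcls ⟨Quotient.mk _ Q, Q, hQ, rfl⟩)
    exact hd.map_iso (G.mapIso e.symm) (h.finite _) (h.finite _)
  let t : 𝓔.simpleClasses → 𝓔.indecProjectiveClasses → ℚ := fun k => d (G.obj (T k))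
  have hspanC : ∀ X, d (G.obj X) ∈ Submodule.span ℚ (Set.range t) := by
    intro X
    obtain ⟨s, hs⟩ := h.exists_isComposition X
    rw [h.apply_eq_sum_factors hd s]
    refine list_sum_mem fun v hv => ?_
    obtain ⟨Q, hQ, rfl⟩ := List.mem_map.1 hv
    rw [hclass Q (hs Q hQ)]
    exact Submodule.subset_span ⟨_, rfl⟩
  -- The basis vectors are the values of `d` on the modules `S j`, which have finite resolutions by
  -- objects of `⊥U`.
  have hspan : ⊤ ≤ Submodule.span ℚ (Set.range t) := by
    rw [← (Pi.basisFun ℚ 𝓔.indecProjectiveClasses).span_eq, Submodule.span_le]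
    rintro _ ⟨j, rfl⟩
    have hSj : Module.Finite A (S j) := inferInstance
    have := hd.mem_of_extBounded (U := U) (Submodule.span ℚ (Set.range t)).toAddSubgroup
      (fun M hM => by
        obtain ⟨X, ⟨e⟩⟩ := h.exists_iso M hM
        rw [← hd.map_iso e (h.finite X) hM.1]
        exact hspanC X) n (S j) (extBounded_of_hasInjectiveDimensionLE _)
    rw [hdS] at this
    rwa [Pi.basisFun_apply]
  constructor
  · intro hJH
    obtain ⟨m, hm, hiso, hsimple⟩ := h.exists_additive_of_jordanHolder hJH
    obtain ⟨m', hm', he⟩ := h.exists_additiveOn_finite n hm hiso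
    -- This map expresses `m'` through `d`: the two agree on simple modules, hence on all finitely
    -- generated ones.
    let L := Fintype.linearCombination ℚ fun j => m' (S j)
    have hL : ∀ M : ModuleCat.{u} A, Module.Finite A M → L (d M) = m' M := by
      intro M hM
      have hdiff : AdditiveOn (fun M : ModuleCat.{u} A => Module.Finite A M)
          fun M => L (d M) - m' M := by
        intro S hS h₁ h₂ h₃
        dsimp only
        rw [hd S hS h₁ h₂ h₃, hm' S hS h₁ h₂ h₃, map_add]
        abel
      refine sub_eq_zero.1 ((AddSubgroup.mem_bot).1 (hdiff.mem_of_simple ⊥ (fun N hN => ?_) M))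
      obtain ⟨j, ⟨e⟩⟩ := hS' N hN
      have hNf : Module.Finite A N := inferInstance
      have hSj : Module.Finite A (S j) := inferInstance
      rw [AddSubgroup.mem_bot, hdiff.map_iso e hNf hSj, hdS]
      simp [L, Fintype.linearCombination_apply_single]
    -- `L` carries the family `t` to distinct standard basis vectors, so no relation among its
    -- members can exist.
    have hli : LinearIndependent ℚ t := by
      refine LinearIndependent.of_comp L ?_
      have hLt : L ∘ t = (fun q => Finsupp.single q (1 : ℚ)) ∘ Subtype.val := by
        funext k
        change L (d (G.obj (T k))) = Finsupp.single k.1 1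
        rw [hL _ (h.finite _), he, hsimple _ (hT k), hcls]
      rw [hLt]
      exact (Finsupp.linearIndependent_single_one ℚ _).comp _ Subtype.val_injective
    exact mk_eq_mk_of_basis' (Module.Basis.mk hli hspan) (Pi.basisFun ℚ _)
  · intro hcard
    obtain ⟨eqv⟩ := Cardinal.eq.1 hcard
    have : Finite 𝓔.simpleClasses := Finite.of_equiv _ eqv.symm
    have := Fintype.ofFinite 𝓔.simpleClasses
    have hli : LinearIndependent ℚ t := linearIndependent_of_top_le_span_of_card_eq_finrank hspan
      (by rw [Module.finrank_fintype_fun_eq_card, Fintype.card_congr eqv])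
    let B := Module.Basis.mk hli hspan
    -- Since the vectors of the simple objects form a basis, reading off coordinates recovers the
    -- formal sum of composition factors from `d` alone.
    let L : (𝓔.indecProjectiveClasses → ℚ) →ₗ[ℚ] (Quotient (isIsomorphicSetoid C) →₀ ℚ) :=
      B.constr ℚ fun k => Finsupp.single k.1 1
    have key : ∀ {X : C} (s : 𝓔.InflationSeries X), s.IsComposition →
        s.classSum = L (d (G.obj X)) := by
      intro X s hs
      rw [h.apply_eq_sum_factors hd s, map_list_sum, List.map_map, classSum]
      congr 1
      refine List.map_congr_left fun Q hQ => ?_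
      change _ = L (d (G.obj Q))
      rw [hclass Q (hs Q hQ)]
      have : d (G.obj (T ⟨Quotient.mk _ Q, Q, hs Q hQ, rfl⟩)) =
        B ⟨Quotient.mk _ Q, Q, hs Q hQ, rfl⟩ := (Module.Basis.mk_apply hli hspan _).symm
      rw [this, Module.Basis.constr_basis]
    exact ⟨h.isLength, fun X s t hs ht =>
      (isomorphic_iff_classSum_eq s t).2 ((key s hs).trans (key t ht).symm)⟩

end IsPerpRealization

end Counting

/-! ### Passage to the given artin algebra -/

theorem isArtinianRing_mulOpposite (R Λ : Type*) [CommRing R] [IsArtinianRing R] [Ring Λ]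
    [Algebra R Λ] [Module.Finite R Λ] : IsArtinianRing Λᵐᵒᵖ :=
  have : Module.Finite R Λᵐᵒᵖ := Module.Finite.equiv (MulOpposite.opLinearEquiv R)
  IsArtinianRing.of_finite R Λᵐᵒᵖ

/-- The class `perp Λ U` is by definition `extBounded U 0` over the opposite ring, and conflations
in it are tested in the module category. -/
theorem isPerpRealization_of_equivalence {Λ : Type u} [Ring Λ] (U : ModuleCat.{u} Λᵐᵒᵖ)
    {C : Type u'} [Category.{v'} C] [Preadditive C] [HasZeroObject C] [HasBinaryBiproducts C]
    {𝓔 : ExactStructure C} (F : C ≌ (perp Λ U).FullSubcategory)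
    [(F.functor ⋙ (perp Λ U).ι).Additive]
    (hF : ∀ S : ShortComplex C, 𝓔.conflation S ↔
      (ExactStructure.ofExtensionClosed (perp Λ U)).conflation (S.map F.functor)) :
    IsPerpRealization 𝓔 (F.functor ⋙ (perp Λ U).ι) U where
  conflation_iff := hF
  mem X := (F.functor.obj X).property
  exists_iso M hM := ⟨F.inverse.obj ⟨M, hM⟩, ⟨(perp Λ U).ι.mapIso (F.counitIso.app ⟨M, hM⟩)⟩⟩

theorem theorem5p9 {R : Type*} [CommRing R] [IsArtinianRing R]
    {Λ : Type u} [Ring Λ] [Algebra R Λ] [Module.Finite R Λ]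
    (U : ModuleCat.{u} Λᵐᵒᵖ) [Module.Finite Λᵐᵒᵖ U] (hU : ∃ n : ℕ, HasInjectiveDimensionLE U n)
    {C : Type u'} [Category.{v'} C] [Preadditive C] [HasZeroObject C] [HasBinaryBiproducts C]
    (𝓔 : ExactStructure C)
    (h𝓔 : ExactEquivalent 𝓔 (ExactStructure.ofExtensionClosed (perp Λ U))) :
    𝓔.JordanHolder ↔
      Cardinal.mk 𝓔.simpleClasses = Cardinal.mk 𝓔.indecProjectiveClasses := by
  have := isArtinianRing_mulOpposite R Λ
  obtain ⟨n, hn⟩ := hU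
  obtain ⟨F, hF⟩ := h𝓔
  -- The equivalence is not assumed additive; it is so because it preserves binary products.
  have : F.functor.Additive := F.functor.additive_of_preserves_binary_products
  exact (isPerpRealization_of_equivalence U F hF).jordanHolder_iff n
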